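/- Let $E$ be a field of characteristic zero, let $n\ge 0$ be an integer, and let the non-trivial element of $\mathbb{Z}/2$ act on the power series ring $A=E[[x_1,\dots,x_n]]$ by the $E$-algebra automorphism $f(x_1,\dots,x_n)\mapsto f(-x_1,\dots,-x_n)$. Let $B=A^{\mathbb{Z}/2}$ be the ring of invariants. Then $B$ is a normal domain and a Cohen–Macaulay (Noetherian) local ring. Moreover: 1. If $n=1$, then $B$ is regular. 2. If $n=2$, then $B$ is a complete intersection but not regular. 3. If $n$ is odd and $n\ge 3$, then $B$ is $2$-Gorenstein but not Gorenstein. 4. If $n$ is even and $n\ge 4$, then $B$ is Gorenstein but not a complete intersection. Here a Noetherian local ring is called a complete intersection if its completion is the quotient of a regular local ring by a regular sequence, and Gorenstein if it has finite injective dimension as a module over itself. A normal Cohen–Macaulay local domain $R$ is called $2$-Gorenstein if it has a canonical module $\omega$ such that the reflexive hull $(\omega\otimes_R\omega)^{**}$ is free of rank one. A canonical module of a $d$-dimensional Cohen–Macaulay local ring $R$ with residue field $k$ is a finitely generated $R$-module of depth $d$ and of finite injective dimension with $\operatorname{Ext}^d_R(k,\omega)\cong k$. -/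

import Mathlib

open IsLocalRing CategoryTheory
open scoped TensorProduct

universe u

section LocalRings

/-- A finitely generated module `M` over a Noetherian local ring `R` is maximal Cohen-Macaulay
if its depth equals `dim R`, i.e. if there is an `M`-regular sequence in the maximal ideal whose
length is the Krull dimension of `R` (a longer one never exists). -/
structure IsMaximalCohenMacaulay (R : Type u) [CommRing R] [IsLocalRing R]
    (M : Type u) [AddCommGroup M] [Module R M] : Prop where
  finite : Module.Finite R M
  exists_isRegular : ∃ rs : List R, (∀ r ∈ rs, r ∈ maximalIdeal R) ∧
    RingTheory.Sequence.IsRegular M rs ∧ (rs.length : WithBot ℕ∞) = ringKrullDim R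

/-- Cohen-Macaulay local rings: Noetherian local rings whose depth is their dimension. -/
class IsCohenMacaulayLocalRing (R : Type u) [CommRing R] : Prop extends
    IsLocalRing R, IsNoetherianRing R where
  isMaximalCohenMacaulay : IsMaximalCohenMacaulay R R

/-- Complete intersection local rings: Noetherian local rings whose completion is the quotient
of a regular local ring by a regular sequence. -/
class IsCompleteIntersectionLocalRing (R : Type u) [CommRing R] : Prop extends
    IsLocalRing R, IsNoetherianRing R where
  exists_presentation : ∃ (S : Type u) (_ : CommRing S) (_ : IsRegularLocalRing S) (rs : List S),
    RingTheory.Sequence.IsRegular S rs ∧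
      Nonempty ((S ⧸ Ideal.ofList rs) ≃+* AdicCompletion (maximalIdeal R) R)

/-- Gorenstein local rings: Noetherian local rings which have finite injective dimension as
modules over themselves. -/
class IsGorensteinLocalRing (R : Type u) [CommRing R] : Prop extends
    IsLocalRing R, IsNoetherianRing R where
  exists_hasInjectiveDimensionLE : ∃ m : ℕ, HasInjectiveDimensionLE (ModuleCat.of R R) m

/-- A canonical (dualizing) module of a Cohen-Macaulay local ring `R` of dimension `d` with
residue field `k`: a maximal Cohen-Macaulay module `ω` of finite injective dimension and of
type `1`, the latter meaning that `Ext^d(k, ω)` is one-dimensional over `k`. -/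
structure IsCanonicalModule (R : Type u) [CommRing R] [IsCohenMacaulayLocalRing R]
    (ω : Type u) [AddCommGroup ω] [Module R ω] : Prop where
  isMaximalCohenMacaulay : IsMaximalCohenMacaulay R ω
  exists_hasInjectiveDimensionLE : ∃ m : ℕ, HasInjectiveDimensionLE (ModuleCat.of R ω) m
  type_eq_one : ∀ d : ℕ, (d : WithBot ℕ∞) = ringKrullDim R →
    Nonempty (Abelian.Ext (ModuleCat.of R (ResidueField R)) (ModuleCat.of R ω) d
      ≃ₗ[R] ResidueField R)

/-- `2`-Gorenstein local rings: normal Cohen-Macaulay local domains with a canonical module `ω`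
such that `ω^[2]`, the reflexive hull (double dual) of `ω ⊗ ω`, is free of rank one. -/
class IsTwoGorensteinLocalRing (R : Type u) [CommRing R] : Prop extends
    IsCohenMacaulayLocalRing R, IsDomain R, IsIntegrallyClosed R where
  exists_canonicalModule : ∃ (ω : Type u) (_ : AddCommGroup ω) (_ : Module R ω),
    IsCanonicalModule R ω ∧
      Nonempty (Module.Dual R (Module.Dual R (ω ⊗[R] ω)) ≃ₗ[R] R)

end LocalRings

section Quotient

variable (E : Type u) [Field E] (n : ℕ)

/-- The `E`-algebra endomorphism `f(x₁, …, xₙ) ↦ f(-x₁, …, -xₙ)` of `E⟦x₁, …, xₙ⟧` is an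
involution. -/
lemma negVars_comp_negVars :
    (MvPowerSeries.rescaleAlgHom (R := E) (fun _ : Fin n => (-1 : E))).comp
      (MvPowerSeries.rescaleAlgHom (fun _ : Fin n => (-1 : E))) = AlgHom.id E _ := by
  rw [← MvPowerSeries.rescaleAlgHom_mul, ← MvPowerSeries.rescaleAlgHom_one]
  congr 1
  funext i
  simp

/-- The automorphism `f(x₁, …, xₙ) ↦ f(-x₁, …, -xₙ)` of `E⟦x₁, …, xₙ⟧`. -/
noncomputable def negVars : MvPowerSeries (Fin n) E ≃ₐ[E] MvPowerSeries (Fin n) E :=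
  AlgEquiv.ofAlgHom (MvPowerSeries.rescaleAlgHom (fun _ : Fin n => (-1 : E)))
    (MvPowerSeries.rescaleAlgHom (fun _ : Fin n => (-1 : E)))
    (negVars_comp_negVars E n) (negVars_comp_negVars E n)

lemma negVars_mul_negVars : negVars E n * negVars E n = 1 := by
  ext1 f
  exact DFunLike.congr_fun (negVars_comp_negVars E n) f

/-- The action of `ℤ/2` on `E⟦x₁, …, xₙ⟧` whose non-trivial element sends each `xᵢ` to `-xᵢ`. -/
noncomputable def negAction :
    Multiplicative (ZMod 2) →* (MvPowerSeries (Fin n) E ≃ₐ[E] MvPowerSeries (Fin n) E) where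
  toFun h := negVars E n ^ (Multiplicative.toAdd h).val
  map_one' := by simp
  map_mul' a b := by
    have h2 : negVars E n ^ 2 = 1 := by rw [pow_two, negVars_mul_negVars]
    rw [← pow_add, toAdd_mul, ZMod.val_add, ← pow_eq_pow_mod _ h2]

/-- The ring of invariants `E⟦x₁, …, xₙ⟧^{ℤ/2}`. -/
noncomputable def evenInvariants : Subalgebra E (MvPowerSeries (Fin n) E) where
  carrier := {f | ∀ h : Multiplicative (ZMod 2), negAction E n h f = f}
  mul_mem' ha hb h := by rw [map_mul, ha h, hb h]
  add_mem' ha hb h := by rw [map_add, ha h, hb h]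
  algebraMap_mem' r h := AlgEquiv.commutes _ r

end Quotient

/-! Write `A` for the power series ring. Since `2 ≠ 0`, `B` consists of the series whose monomials
all have even degree, and `A = B ⊕ W` with `W` the odd part. An exponent is uniquely `2m + s` with
`s` squarefree. So `B` is free over the subring `A'` of power series in the squares `xᵢ²`, with
basis the even squarefree monomials (`linearEquivPi`), and the `xᵢ²` form a regular sequence on `B`
and on `W` with finite length quotient of `B`. This gives that `B` is Noetherian and Cohen-Macaulay
of dimension `n`, and turns socle computations into combinatorics of squarefree exponents.

Duality: over the regular ring `A'` every module has injective dimension at most `n`, and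
coextension along the free extension `A' → B` preserves this bound. Taking the part of a series
along `x₁⋯xₙ` pairs the monomial of `s` with that of the complement of `s`. Hence `Hom(B, A')` is
the part of `A` of the parity of `n` (`toCoextendScalars_bijective`): it is `B` for even `n`, so `B`
is Gorenstein, and `W` for odd `n`, which is then canonical. For `n ≥ 2` every bilinear form `W × W
→ B` is a multiple of multiplication (`exists_eq_mul_oddMul`), so `(W ⊗ W)*` and its dual are free
of rank one.

Not Gorenstein for odd `n ≥ 3`: finite injective dimension would make the socle of `B/(xᵢ²)` cyclic
(`exists_sub_mul_mem_of_hasInjectiveDimensionLE`), yet all products of `n - 1` distinct variables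
lie in it.

Not a complete intersection for `n ≥ 3`: the maximal ideal needs all `n(n+1)/2` products `xᵢxⱼ`, so
a complete intersection would have a minimal presentation with only `n(n-1)/2` relations; but
`n(n-1)/2 + 1` independent quadratic relations are visible (`false_of_presentation`). For `n = 2`
the only relation is `T² = uv`, and Weierstrass division presents `B` as a hypersurface.

Normality: complete integral closedness, unlike mere integral closedness, is easily carried from `R`
to `R⟦X⟧` by comparing lowest terms, and it descends from `A` to `B`. -/

/-! ### Injective dimension: test on cyclic modules, and behaviour under coextension. -/

section InjectiveDimension

open Abelian

variable {R : Type u} [CommRing R]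

/-- Baer's criterion in terms of `Ext¹` of cyclic modules. -/
theorem Module.Baer.of_subsingleton_ext_one {M : ModuleCat.{u} R}
    (h : ∀ I : Ideal R, Subsingleton (Ext (ModuleCat.of R (R ⧸ I)) M 1)) : Module.Baer R M := by
  intro I g
  have hex : Function.Exact I.subtype I.mkQ := by
    intro x
    simp [Ideal.Quotient.eq_zero_iff_mem]
  let S : ShortComplex (ModuleCat.{u} R) :=
    ModuleCat.shortComplexOfCompEqZero I.subtype I.mkQ hex.linearMap_comp_eq_zero
  have hS : S.ShortExact := ModuleCat.shortComplex_shortExact S hex I.injective_subtype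
    (Submodule.mkQ_surjective _)
  have : Subsingleton (Ext S.X₃ M 1) := h I
  obtain ⟨x, hx⟩ := Ext.contravariant_sequence_exact₁ hS M (Ext.mk₀ (ModuleCat.ofHom g))
    (add_zero 1) (Subsingleton.elim _ _)
  obtain ⟨φ, rfl⟩ := Ext.homEquiv₀.symm.surjective x
  rw [Ext.homEquiv₀_symm_apply, Ext.mk₀_comp_mk₀] at hx
  have hx := (Ext.mk₀_bijective _ _).1 hx
  refine ⟨φ.hom, fun x hxI => ?_⟩
  exact congr($(hx).hom ⟨x, hxI⟩)

/-- Dimension shifting: for `0 → M → I → M' → 0` with `I` injective, every class in `Ext^(n+1)(R/J,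
M')` with zero image in `Ext^(n+2)(R/J, M)` comes from `Ext^(n+1)(R/J, I) = 0`. The base case is
Baer's criterion. -/
theorem ModuleCat.hasInjectiveDimensionLE_of_forall_ideal {M : ModuleCat.{u} R} {n : ℕ}
    (h : ∀ I : Ideal R, Subsingleton (Ext (ModuleCat.of R (R ⧸ I)) M (n + 1))) :
    HasInjectiveDimensionLE M n := by
  induction n generalizing M with
  | zero =>
    have h1 := Module.Baer.of_subsingleton_ext_one h
    rw [Module.Baer.iff_injective] at h1
    have : Injective M := (Module.injective_iff_injective_object R M).mp h1
    exact injective_iff_hasInjectiveDimensionLT_one.mp this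
  | succ n ih =>
    let ⟨I, _, f, _⟩ := EnoughInjectives.presentation M
    let S : ShortComplex (ModuleCat.{u} R) :=
      ShortComplex.mk f (Limits.cokernel.π f) (Limits.cokernel.condition f)
    have hS : S.ShortExact := { exact := ShortComplex.exact_cokernel f }
    refine (hS.hasInjectiveDimensionLT_X₃_iff n ‹_›).mp (ih fun J => ?_)
    refine ⟨fun x y => sub_eq_zero.mp ?_⟩
    have : Subsingleton (Ext (ModuleCat.of R (R ⧸ J)) S.X₁ (n + 2)) := h J
    obtain ⟨z, hz⟩ := Ext.covariant_sequence_exact₃ _ hS (x - y) rfl (Subsingleton.elim _ _)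
    rw [← hz, show z = 0 from Ext.eq_zero_of_injective (I := I) z, Ext.zero_comp]

/-- Coextension is `Hom_R(S, -)`, which is exact because `S` is projective over `R`. -/
theorem ModuleCat.coextendScalars_shortExact {S : Type u} [CommRing S] (f : R →+* S)
    (hf : Module.Projective R ((ModuleCat.restrictScalars f).obj (ModuleCat.of S S)))
    {T : ShortComplex (ModuleCat.{u} R)} (hT : T.ShortExact) :
    (T.map (ModuleCat.coextendScalars.{u, u} f)).ShortExact := by
  have hex := (ShortComplex.ShortExact.moduleCat_exact_iff_function_exact _).mp hT.exact
  have hinj : Function.Injective T.f := (ModuleCat.mono_iff_injective _).mp hT.mono_f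
  have hsurj : Function.Surjective T.g := (ModuleCat.epi_iff_surjective _).mp hT.epi_g
  refine ModuleCat.shortComplex_shortExact _ ?_ ?_ ?_
  · intro φ
    constructor
    · intro h
      let φ' := CoextendScalars.equiv f _ φ
      have h0 : ∀ s, T.g (φ' s) = 0 := fun s =>
        congr(CoextendScalars.equiv f _ $h s)
      have : LinearMap.range φ' ≤ LinearMap.range T.f.hom := by
        rintro _ ⟨s, rfl⟩
        exact (hex _).mp (h0 s)
      obtain ⟨ψ, hψ⟩ := Module.projective_lifting_property (T.f.hom.rangeRestrict)
        (φ'.codRestrict _ fun s => this ⟨s, rfl⟩) (LinearMap.surjective_rangeRestrict _)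
      refine ⟨(CoextendScalars.equiv f _).symm ψ, ?_⟩
      apply (CoextendScalars.equiv f _).injective
      ext s
      exact congr(($hψ s : T.X₂))
    · rintro ⟨ψ, rfl⟩
      apply (CoextendScalars.equiv f _).injective
      ext s
      exact hex.apply_apply_eq_zero _
  · intro φ ψ h
    apply (CoextendScalars.equiv f _).injective
    ext s
    exact hinj congr(CoextendScalars.equiv f _ $h s)
  · intro φ
    obtain ⟨ψ, hψ⟩ := Module.projective_lifting_property T.g.hom
      (CoextendScalars.equiv f _ φ) hsurj
    refine ⟨(CoextendScalars.equiv f _).symm ψ, ?_⟩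
    apply (CoextendScalars.equiv f _).injective
    ext s
    exact congr($hψ s)

/-- Coextension is right adjoint to the exact restriction functor, so it preserves injectives; being
exact here as well, it carries an injective embedding and its cokernel to the same data. -/
theorem ModuleCat.hasInjectiveDimensionLE_coextendScalars {S : Type u} [CommRing S] (f : R →+* S)
    (hf : Module.Projective R ((ModuleCat.restrictScalars f).obj (ModuleCat.of S S)))
    (M : ModuleCat.{u} R) (n : ℕ) [HasInjectiveDimensionLE M n] :
    HasInjectiveDimensionLE ((ModuleCat.coextendScalars.{u, u} f).obj M) n := by
  have hinj (I : ModuleCat.{u} R) (hI : Injective I) :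
      Injective ((ModuleCat.coextendScalars.{u, u} f).obj I) :=
    Injective.injective_of_adjoint (ModuleCat.restrictCoextendScalarsAdj f) I
  induction n generalizing M with
  | zero =>
    have : HasInjectiveDimensionLE M 0 := ‹_›
    simp only [HasInjectiveDimensionLE, zero_add, ← injective_iff_hasInjectiveDimensionLT_one]
      at this ⊢
    exact hinj M this
  | succ n ih =>
    let ⟨I, _, g, _⟩ := EnoughInjectives.presentation M
    let T : ShortComplex (ModuleCat.{u} R) :=
      ShortComplex.mk g (Limits.cokernel.π g) (Limits.cokernel.condition g)
    have hT : T.ShortExact := { exact := ShortComplex.exact_cokernel g }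
    have := (hT.hasInjectiveDimensionLT_X₃_iff n ‹_›).mpr ‹_›
    exact ((coextendScalars_shortExact f hf hT).hasInjectiveDimensionLT_X₃_iff n
      (hinj I ‹_›)).mp (ih T.X₃)

end InjectiveDimension

/-! ### Modules of finite length and vanishing of Ext. -/

section FiniteLength

open Abelian

variable {R : Type u} [CommRing R]

theorem IsFiniteLength.of_isArtinianRing_quotient [IsNoetherianRing R] (I : Ideal R)
    [IsArtinianRing (R ⧸ I)] (N : Type*) [AddCommGroup N] [Module R N] [Module.Finite R N]
    (hN : Module.IsTorsionBySet R N I) : IsFiniteLength R N := by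
  let := hN.module
  have : IsScalarTower R (R ⧸ I) N := hN.isScalarTower
  have : Module.Finite (R ⧸ I) N := Module.Finite.of_restrictScalars_finite R _ _
  have : IsArtinian R N := isArtinian_of_surjective_algebraMap (S := R) (R := R ⧸ I)
    Ideal.Quotient.mk_surjective
  exact isFiniteLength_iff_isNoetherian_isArtinian.mpr ⟨inferInstance, this⟩

/-- Induction on the length: over a local ring each simple factor is the residue field, and in the
long exact sequence the middle term vanishes with its neighbours. -/
theorem ModuleCat.subsingleton_ext_of_isFiniteLength [IsLocalRing R] {M : ModuleCat.{u} R} {n : ℕ}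
    (h : Subsingleton (Ext (ModuleCat.of R (R ⧸ maximalIdeal R)) M n)) {N : Type u} [AddCommGroup N]
    [Module R N] (hN : IsFiniteLength R N) : Subsingleton (Ext (ModuleCat.of R N) M n) := by
  induction hN with
  | of_subsingleton =>
    refine ⟨fun x y => sub_eq_zero.mp ?_⟩
    rw [← (x - y).mk₀_id_comp, (ModuleCat.isZero_iff_subsingleton.mpr ‹_›).eq_of_src (𝟙 _) 0,
      Ext.mk₀_zero, Ext.zero_comp]
  | @of_simple_quotient N _ _ L hL _ ih =>
    let S : ShortComplex (ModuleCat.{u} R) := ModuleCat.shortComplexOfCompEqZero L.subtype L.mkQ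
      (LinearMap.exact_subtype_mkQ L).linearMap_comp_eq_zero
    have hS : S.ShortExact := ModuleCat.shortComplex_shortExact S (LinearMap.exact_subtype_mkQ L)
      L.injective_subtype L.mkQ_surjective
    have : Subsingleton (Ext S.X₁ M n) := ih
    have : Subsingleton (Ext S.X₃ M n) := by
      obtain ⟨I, hI, ⟨e⟩⟩ := isSimpleModule_iff_quot_maximal.mp hL
      obtain rfl := IsLocalRing.eq_maximalIdeal hI
      let e' : S.X₃ ≅ ModuleCat.of R (R ⧸ maximalIdeal R) := e.toModuleIso
      refine ⟨fun x y => ?_⟩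
      have := Subsingleton.elim ((Ext.mk₀ e'.inv).comp x (zero_add n))
        ((Ext.mk₀ e'.inv).comp y (zero_add n))
      have := congr((Ext.mk₀ e'.hom).comp $this (zero_add n))
      simpa using this
    refine ⟨fun x y => sub_eq_zero.mp ?_⟩
    obtain ⟨z, hz⟩ := Ext.contravariant_sequence_exact₂ hS M (x - y) (Subsingleton.elim _ _)
    rw [← hz, Subsingleton.elim z 0, Ext.comp_zero]

end FiniteLength

/-! ### Finite global dimension when a regular sequence generates the maximal ideal. -/

section GlobalDimension

open RingTheory.Sequence

variable {R : Type u} [CommRing R]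

/-- The first syzygy gains depth: in an exact sequence `0 → K → F → M → 0`, a sequence `rs, y` that
is regular on `F` is regular on `K` as soon as `rs` is regular on `M`. -/
theorem RingTheory.Sequence.IsWeaklyRegular.of_exact_append_singleton {rs : List R} {y : R}
    {K F M : Type u} [AddCommGroup K] [AddCommGroup F] [AddCommGroup M] [Module R K] [Module R F]
    [Module R M] {f : K →ₗ[R] F} {g : F →ₗ[R] M} (hf : Function.Injective f)
    (hfg : Function.Exact f g) (hg : Function.Surjective g) (hM : IsWeaklyRegular M rs)
    (hF : IsWeaklyRegular F (rs ++ [y])) : IsWeaklyRegular K (rs ++ [y]) := by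
  induction rs generalizing K F M with
  | nil =>
    simp only [List.nil_append, isWeaklyRegular_singleton_iff] at hF ⊢
    exact hF.of_injective f hf
  | cons r rs ih =>
    simp only [List.cons_append, isWeaklyRegular_cons_iff] at hM hF ⊢
    refine ⟨hF.1.of_injective f hf, ih (f := QuotSMulTop.map r f) (g := QuotSMulTop.map r g) ?_
      (QuotSMulTop.map_exact r hfg hg) (QuotSMulTop.map_surjective r hg) hM.2 hF.2⟩
    -- Because `r` is regular on `M`, the map `K/rK → F/rF` stays injective. The zero map from
    -- `PUnit` only pads the sequence to four terms.
    have h0 : Function.Exact (0 : PUnit.{u+1} →ₗ[R] K) f := by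
      rw [LinearMap.exact_zero_iff_injective]
      exact hf
    have := QuotSMulTop.map_first_exact_on_four_term_exact_of_isSMulRegular_last h0 hfg hM.1
    rw [map_zero, LinearMap.exact_zero_iff_injective] at this
    exact this

variable [IsLocalRing R] [IsNoetherianRing R]

theorem ModuleCat.hasProjectiveDimensionLE_quotient {rs : List R} (reg : IsRegular R rs) :
    HasProjectiveDimensionLE (ModuleCat.of R (R ⧸ (Ideal.ofList rs • ⊤ : Submodule R R)))
      rs.length := by
  have mem : ∀ r ∈ rs, r ∈ maximalIdeal R := fun r hr =>
    IsLocalRing.le_maximalIdeal (by simpa using reg.2.symm) (Ideal.subset_span hr)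
  have h := projectiveDimension_quotient_eq_add_length_of_isWeaklyRegular (ModuleCat.of R R) rs
    reg.1 mem
  rw [ModuleCat.projectiveDimension_eq_zero_of_projective (ModuleCat.of R R), zero_add] at h
  rw [← projectiveDimension_le_iff]
  exact h.le

/-- The residue field is `R/(rs)`, of projective dimension at most `rs.length`; dévissage extends
the bound to finite length. -/
theorem ModuleCat.hasProjectiveDimensionLE_of_isFiniteLength {rs : List R}
    (reg : IsRegular R rs) (h : Ideal.ofList rs = maximalIdeal R)
    {N : Type u} [AddCommGroup N] [Module R N] (hN : IsFiniteLength R N) :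
    HasProjectiveDimensionLE (ModuleCat.of R N) rs.length := by
  have hk : HasProjectiveDimensionLE (ModuleCat.of R (R ⧸ maximalIdeal R)) rs.length := by
    have h1 := hasProjectiveDimensionLE_quotient reg
    have e : (R ⧸ (Ideal.ofList rs • ⊤ : Submodule R R)) ≃ₗ[R] (R ⧸ maximalIdeal R) :=
      Submodule.quotEquivOfEq _ _ (by rw [smul_eq_mul, Ideal.mul_top, h])
    exact hasProjectiveDimensionLT_of_iso e.toModuleIso _
  refine (hasProjectiveDimensionLT_iff _ _).mpr fun i hi Y e => ?_
  have := subsingleton_ext_of_isFiniteLength (M := Y) (n := i)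
    (HasProjectiveDimensionLT.subsingleton _ _ i hi Y) hN
  exact Subsingleton.elim _ _

/-- Taking a syzygy lowers the wanted bound by one and lengthens the initial segment of `rs` that is
regular on the module. Once all of `rs` is regular on `M`, the quotient `M/rs M` has finite length,
so `pd M + rs.length = pd (M/rs M) ≤ rs.length` makes `M` projective. -/
theorem ModuleCat.hasProjectiveDimensionLE_of_isRegular {rs : List R}
    (reg : IsRegular R rs) (h : Ideal.ofList rs = maximalIdeal R)
    (M : ModuleCat.{u} R) [Module.Finite R M] : HasProjectiveDimensionLE M rs.length := by
  have mem : ∀ r ∈ rs, r ∈ maximalIdeal R := fun r hr => h ▸ Ideal.subset_span hr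
  -- Split `rs` into a part `as` already regular on `M` and the rest `bs`, whose length is the bound
  -- to prove.
  suffices ∀ (bs as : List R) (M : ModuleCat.{u} R) [Module.Finite R M], as ++ bs = rs →
      IsWeaklyRegular M as → HasProjectiveDimensionLE M bs.length from
    this rs [] M rfl (.nil R M)
  intro bs
  induction bs with
  | nil =>
    rintro as M _ rfl hM
    rw [List.append_nil] at *
    rcases subsingleton_or_nontrivial M with hs | hs
    · have := ((ModuleCat.isZero_iff_subsingleton (M := M)).mpr hs).hasProjectiveDimensionLT_zero
      exact hasProjectiveDimensionLT_of_ge M 0 _ (Nat.zero_le _)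
    have h1 := projectiveDimension_quotient_eq_add_length_of_isWeaklyRegular M as hM mem
    have hfl : IsFiniteLength R (M ⧸ Ideal.ofList as • (⊤ : Submodule R M)) := by
      let := Ideal.Quotient.field (maximalIdeal R)
      refine .of_isArtinianRing_quotient (maximalIdeal R) _ ?_
      rintro n ⟨r, hr⟩
      rw [SetLike.mem_coe, ← h] at hr
      obtain ⟨n, rfl⟩ := Submodule.mkQ_surjective _ n
      rw [← map_smul, Submodule.mkQ_apply, Submodule.Quotient.mk_eq_zero]
      exact Submodule.smul_mem_smul hr trivial
    have h2 := hasProjectiveDimensionLE_of_isFiniteLength reg h hfl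
    rw [← projectiveDimension_le_iff, h1] at h2
    rw [← projectiveDimension_le_iff, List.length_nil]
    generalize projectiveDimension M = d at h2
    have : d + (as.length : WithBot ℕ∞) ≤ ((0 : ℕ) : WithBot ℕ∞) + (as.length : ℕ) := by simpa using h2
    exact (ENat.WithBot.add_le_add_natCast_right_iff).mp this
  | cons b bs ih =>
    intro as M _ hab hM
    obtain ⟨F, _, _, _, _, f, hf⟩ := Module.exists_finite_presentation R M
    have hS := LinearMap.shortExact_shortComplexKer hf
    have hF : IsWeaklyRegular F (as ++ [b]) := by
      have h1 : IsWeaklyRegular R (as ++ [b]) := by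
        have := reg.toIsWeaklyRegular
        rw [← hab, ← List.singleton_append, ← List.append_assoc, isWeaklyRegular_append_iff] at this
        exact this.1
      exact ((TensorProduct.lid R F).isWeaklyRegular_congr _).mp h1.isWeaklyRegular_rTensor
    have hK := IsWeaklyRegular.of_exact_append_singleton (LinearMap.ker f).injective_subtype
      (LinearMap.exact_subtype_ker_map f) hf hM hF
    have := ih (as ++ [b]) (ModuleCat.of R (LinearMap.ker f)) (by simpa using hab) hK
    exact hS.hasProjectiveDimensionLT_X₃ _ this
      (hasProjectiveDimensionLT_of_ge _ 1 _ (by simp))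

/-- No finiteness of `M` is needed: injective dimension is tested on the cyclic modules `R/I`, whose
projective dimension is already bounded. -/
theorem ModuleCat.hasInjectiveDimensionLE_of_isRegular {rs : List R}
    (reg : IsRegular R rs) (h : Ideal.ofList rs = maximalIdeal R) (M : ModuleCat.{u} R) :
    HasInjectiveDimensionLE M rs.length := by
  refine hasInjectiveDimensionLE_of_forall_ideal fun I => ?_
  have := hasProjectiveDimensionLE_of_isRegular reg h (ModuleCat.of R (R ⧸ I))
  exact HasProjectiveDimensionLT.subsingleton _ (rs.length + 1) _ le_rfl _

end GlobalDimension

/-! ### Rees' lemma and the socle of a ring of finite self-injective dimension. -/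

section Rees

open Abelian RingTheory.Sequence

variable {R : Type u} [CommRing R]

theorem CategoryTheory.Abelian.Ext.comp_mk₀_smul_id_eq_zero {N M : ModuleCat.{u} R} {r : R}
    (hr : ∀ x : N, r • x = 0) {i : ℕ} (x : Ext N M i) :
    x.comp (Ext.mk₀ (r • 𝟙 M)) (add_zero i) = 0 := by
  have := Ext.postcomp_smul_id_eq_zero_of_mem_annihilator (M := M)
    (Module.mem_annihilator.mpr hr) i
  exact congr($(this).hom x)

/-- Rees' lemma: for a weakly `M`-regular sequence `rs` of length `l` annihilating `N`, one has
`Ext^i(N, M) = 0` for `i < l`, and `Ext^l(N, M)` is `Hom(N, M / rs M)` by composition with a class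
`θ` independent of `N`. -/
theorem ModuleCat.exists_ext_quotient_bijective (rs : List R) (M : ModuleCat.{u} R)
    (reg : IsWeaklyRegular M rs) :
    ∃ θ : Ext (ModuleCat.of R (M ⧸ (Ideal.ofList rs • ⊤ : Submodule R M))) M rs.length,
      ∀ N : ModuleCat.{u} R, (∀ r ∈ rs, ∀ x : N, r • x = 0) →
        (∀ i < rs.length, Subsingleton (Ext N M i)) ∧
        Function.Bijective (fun f : N ⟶ ModuleCat.of R (M ⧸ (Ideal.ofList rs • ⊤ : Submodule R M)) =>
          (Ext.mk₀ f).comp θ (zero_add _)) := by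
  induction rs generalizing M with
  | nil =>
    let e : ModuleCat.of R (M ⧸ (Ideal.ofList [] • ⊤ : Submodule R M)) ≅ M :=
      (Submodule.quotEquivOfEqBot (Ideal.ofList ([] : List R) • ⊤ : Submodule R M)
        (by rw [Ideal.ofList_nil, Submodule.bot_smul])).toModuleIso
    refine ⟨Ext.mk₀ e.hom, fun N _ => ⟨by simp, ?_⟩⟩
    simp only [Ext.mk₀_comp_mk₀]
    exact (Ext.mk₀_bijective _ _).comp (e.homToEquiv).bijective
  | cons r rs ih =>
    rw [isWeaklyRegular_cons_iff] at reg
    let e := (Submodule.quotOfListConsSMulTopEquivQuotSMulTopInner M r rs).toModuleIso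
    obtain ⟨θ, hθ⟩ := ih (ModuleCat.of R (QuotSMulTop r M)) reg.2
    have hS := reg.1.smulShortComplex_shortExact
    refine ⟨(Ext.mk₀ e.hom).comp (θ.comp hS.extClass rfl) (zero_add _), fun N hN => ?_⟩
    obtain ⟨h1, h2⟩ := hθ N fun a ha => hN a (List.mem_cons_of_mem _ ha)
    have hr := hN r List.mem_cons_self
    -- Multiplication by `r` vanishes on `Ext(N, M)` since `r` kills `N`, so the connecting maps out
    -- of `Ext(N, M/rM)` are onto.
    have hsurj (i : ℕ) (x : Ext N M (i + 1)) :
        ∃ y : Ext N (ModuleCat.of R (QuotSMulTop r M)) i, y.comp hS.extClass rfl = x :=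
      Ext.covariant_sequence_exact₁ N hS x (Ext.comp_mk₀_smul_id_eq_zero hr x) rfl
    have hzero : ∀ i < rs.length + 1, Subsingleton (Ext N M i) := by
      rintro (_ | i) hi
      · refine ⟨fun x y => sub_eq_zero.mp ?_⟩
        have := hS.mono_f
        refine Ext.postcomp_mk₀_injective_of_mono N (M.smulShortComplex r).f ?_
        exact (Ext.comp_mk₀_smul_id_eq_zero hr (x - y)).trans (map_zero _).symm
      · have := h1 i (by lia)
        refine ⟨fun x y => ?_⟩
        obtain ⟨x, rfl⟩ := hsurj i x
        obtain ⟨y, rfl⟩ := hsurj i y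
        rw [Subsingleton.elim x y]
    refine ⟨hzero, ?_⟩
    have hbij : Function.Bijective (hS.extClass.postcomp N (rfl : rs.length + 1 = _)) := by
      refine ⟨(injective_iff_map_eq_zero _).mpr fun x hx => ?_, hsurj _⟩
      obtain ⟨y, rfl⟩ := Ext.covariant_sequence_exact₃ N hS x rfl hx
      have := hzero rs.length (by lia)
      rw [show y = 0 from Subsingleton.elim (α := Ext N M _) _ _, Ext.zero_comp]
    convert! hbij.comp (h2.comp (e.homToEquiv (Z := N)).bijective) using 1
    ext1 f
    exact (Ext.mk₀_comp_mk₀_assoc _ _ _).trans (Ext.comp_assoc _ _ _ (zero_add _) rfl (by simp)).symm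

/-- `Hom(N, M / rs M) ≃ Ext^l(N, M)` for an `M`-regular sequence `rs` of length `l` with
`rs N = 0`. -/
theorem ModuleCat.nonempty_linearEquiv_ext {rs : List R} {M : ModuleCat.{u} R}
    (reg : IsWeaklyRegular M rs) {N : ModuleCat.{u} R} (hN : ∀ r ∈ rs, ∀ x : N, r • x = 0) :
    Nonempty ((N →ₗ[R] (M ⧸ (Ideal.ofList rs • ⊤ : Submodule R M))) ≃ₗ[R] Ext N M rs.length) := by
  obtain ⟨θ, hθ⟩ := exists_ext_quotient_bijective rs M reg
  let φ : (N ⟶ ModuleCat.of R (M ⧸ (Ideal.ofList rs • ⊤ : Submodule R M))) →ₗ[R]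
      Ext N M rs.length :=
    (Ext.postcompOfLinear θ R N (zero_add _)) ∘ₗ (Ext.linearEquiv₀ (R := R)).symm.toLinearMap
  exact ⟨(ModuleCat.homLinearEquiv (S := R)).symm.trans (LinearEquiv.ofBijective φ (hθ N hN).2)⟩

/-- If `R` has finite injective dimension over itself, then the socle of the quotient by a system of
parameters that is a regular sequence is generated by any of its nonzero elements. -/
theorem IsLocalRing.exists_sub_mul_mem_of_hasInjectiveDimensionLE [IsLocalRing R]
    [IsNoetherianRing R] {rs : List R} (reg : IsRegular R rs)
    (hfl : IsFiniteLength R (R ⧸ (Ideal.ofList rs • ⊤ : Submodule R R))) {m : ℕ}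
    (hm : HasInjectiveDimensionLE (ModuleCat.of R R) m) {s t : R}
    (hs : ∀ a ∈ maximalIdeal R, a * s ∈ Ideal.ofList rs)
    (ht : ∀ a ∈ maximalIdeal R, a * t ∈ Ideal.ofList rs) (hs0 : s ∉ Ideal.ofList rs) :
    ∃ b, t - b * s ∈ Ideal.ofList rs := by
  have mem : ∀ r ∈ rs, r ∈ maximalIdeal R := fun r hr =>
    IsLocalRing.le_maximalIdeal (by simpa using reg.2.symm) (Ideal.subset_span hr)
  have htop : (Ideal.ofList rs • ⊤ : Submodule R R) = Ideal.ofList rs := by simp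
  set Q := R ⧸ (Ideal.ofList rs • ⊤ : Submodule R R) with hQ
  have hmk (x : R) : (Submodule.Quotient.mk x : Q) = 0 ↔ x ∈ Ideal.ofList rs := by
    rw [Submodule.Quotient.mk_eq_zero, htop]
  let g (s : R) (hs : ∀ a ∈ maximalIdeal R, a * s ∈ Ideal.ofList rs) : (R ⧸ maximalIdeal R) →ₗ[R] Q :=
    Submodule.liftQ (maximalIdeal R) (LinearMap.toSpanSingleton R Q (Submodule.Quotient.mk s)) (by
      intro a ha
      rw [LinearMap.mem_ker, LinearMap.toSpanSingleton_apply, ← Submodule.Quotient.mk_smul, hmk]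
      exact hs a ha)
  have hg1 (s : R) (hs) (a : R) : g s hs (Submodule.Quotient.mk a) = Submodule.Quotient.mk (a * s) :=
    rfl
  have hinj : Function.Injective (g s hs) := by
    rw [injective_iff_map_eq_zero]
    intro x hx
    obtain ⟨a, rfl⟩ := Submodule.Quotient.mk_surjective _ x
    rw [hg1 s hs, hmk] at hx
    rw [Submodule.Quotient.mk_eq_zero]
    by_contra ha
    exact hs0 ((Ideal.unit_mul_mem_iff_mem _ (IsLocalRing.notMem_maximalIdeal.mp ha)).mp hx)
  have hex := (g s hs).exact_map_mkQ_range
  let S : ShortComplex (ModuleCat.{u} R) :=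
    ModuleCat.shortComplexOfCompEqZero _ _ hex.linearMap_comp_eq_zero
  have hS : S.ShortExact :=
    ModuleCat.shortComplex_shortExact S hex hinj (Submodule.mkQ_surjective _)
  have hcoker {j : ℕ}
      (hj : Subsingleton (Ext (ModuleCat.of R (R ⧸ maximalIdeal R)) (ModuleCat.of R R) j)) :
      Subsingleton (Ext S.X₃ (ModuleCat.of R R) j) :=
    ModuleCat.subsingleton_ext_of_isFiniteLength hj (hfl.of_surjective (Submodule.mkQ_surjective _))
  have hpd := ModuleCat.hasProjectiveDimensionLE_quotient reg
  -- Descending induction shows `Ext^j(k, R) = 0` for all `j > rs.length`, with `d` bounding the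
  -- distance to `m + 1`. In `0 → k → Q → coker → 0`, the term `Ext^j(k, R)` lies between `Ext^j(Q,
  -- R)`, zero by projective dimension, and `Ext^(j+1)(coker, R)`, zero by finite length.
  have hvanish : ∀ d j, rs.length < j → m + 1 ≤ j + d →
      Subsingleton (Ext (ModuleCat.of R (R ⧸ maximalIdeal R)) (ModuleCat.of R R) j) := by
    intro d
    induction d with
    | zero => exact fun j _ hj => HasInjectiveDimensionLT.subsingleton _ (m + 1) j hj _
    | succ d ih =>
      intro j hj hjd
      have := hcoker (ih (j + 1) (by lia) (by lia))
      refine ⟨fun x y => sub_eq_zero.mp ?_⟩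
      obtain ⟨z, hz⟩ := Ext.contravariant_sequence_exact₁ hS _ (x - y) (add_comm 1 j)
        (Subsingleton.elim _ _)
      have : Subsingleton (Ext S.X₂ (ModuleCat.of R R) j) :=
        HasProjectiveDimensionLT.subsingleton _ (rs.length + 1) j hj _
      rw [← hz, Subsingleton.elim z 0, Ext.comp_zero]
  obtain ⟨θ, hθ⟩ := ModuleCat.exists_ext_quotient_bijective rs (ModuleCat.of R R) reg.1
  -- With `l = rs.length`, the class of `g t` in `Ext^l(k, R)` extends along `g s` to `Ext^l(Q, R)`,
  -- the obstruction lying in `Ext^(l+1)(coker, R) = 0`. By Rees' lemma the extension is an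
  -- endomorphism `h` of `Q` with `h ∘ g s = g t`, so `t = s · h(1)` in `Q`.
  have := hcoker (hvanish (m + 1) (rs.length + 1) (by lia) (by lia))
  obtain ⟨z, hz⟩ := Ext.contravariant_sequence_exact₁ hS _
    ((Ext.mk₀ (ModuleCat.ofHom (g t ht))).comp θ (zero_add _)) (add_comm 1 _)
    (Subsingleton.elim _ _)
  obtain ⟨h, hh⟩ := (hθ (ModuleCat.of R Q) (by
    rintro r hr x
    obtain ⟨x, rfl⟩ := Submodule.Quotient.mk_surjective _ x
    rw [← Submodule.Quotient.mk_smul, hmk]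
    exact Ideal.mul_mem_right _ _ (Ideal.subset_span hr))).2.2 z
  have hinj' := (hθ (ModuleCat.of R (R ⧸ maximalIdeal R)) (by
    rintro r hr x
    obtain ⟨x, rfl⟩ := Submodule.Quotient.mk_surjective _ x
    rw [← Submodule.Quotient.mk_smul, Submodule.Quotient.mk_eq_zero]
    exact Ideal.mul_mem_right _ _ (mem r hr))).2.1
  have hcomp : ModuleCat.ofHom (g s hs) ≫ h = ModuleCat.ofHom (g t ht) := by
    apply hinj'
    simp only [← hz, ← hh]
    simp [S]
  obtain ⟨b, hb⟩ := Submodule.Quotient.mk_surjective _ (h.hom (Submodule.Quotient.mk 1))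
  refine ⟨b, ?_⟩
  have h1 : h.hom (g s hs (Submodule.Quotient.mk 1)) = g t ht (Submodule.Quotient.mk 1) :=
    congr($(hcomp).hom _)
  have h2 : g s hs (Submodule.Quotient.mk 1) = s • (Submodule.Quotient.mk 1 : Q) := by
    rw [hg1 s hs, one_mul]
    exact congrArg Submodule.Quotient.mk (mul_one s).symm
  rw [h2, map_smul, ← hb, hg1 t ht, one_mul, ← Submodule.Quotient.mk_smul] at h1
  have h3 : t - s * b ∈ (Ideal.ofList rs • ⊤ : Submodule R R) :=
    (Submodule.Quotient.eq _).mp h1.symm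
  rwa [htop, mul_comm] at h3

end Rees

/-! ### Counting relations in presentations by regular local rings. -/

section Presentations

/-- From `z² = z³c` and `1 - zc` a unit one gets `z² = 0`, so every prime contains the maximal
ideal. -/
theorem IsLocalRing.ringKrullDim_le_zero_of_span_singleton {R : Type*} [CommRing R] [IsLocalRing R]
    {z : R} (hz : maximalIdeal R = Ideal.span {z}) (h : z ^ 2 ∈ maximalIdeal R ^ 3) :
    ringKrullDim R ≤ 0 := by
  have h0 : z ^ 2 = 0 := by
    rw [hz, Ideal.span_singleton_pow, Ideal.mem_span_singleton] at h
    obtain ⟨c, hc⟩ := h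
    have h1 : z ^ 2 * (1 - z * c) = 0 := by linear_combination hc
    have h2 : IsUnit (1 - z * c) := by
      rw [← IsLocalRing.notMem_maximalIdeal]
      intro h3
      have h4 : z * c ∈ maximalIdeal R := hz ▸ Ideal.mul_mem_right _ _ (Ideal.mem_span_singleton_self z)
      have h5 := Ideal.add_mem _ h3 h4
      rw [sub_add_cancel] at h5
      exact (Ideal.ne_top_iff_one _).mp (maximalIdeal.isMaximal R).ne_top h5
    exact (h2.mul_left_eq_zero).mp h1
  have : Ring.KrullDimLE 0 R := by
    rw [Ring.krullDimLE_zero_iff]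
    intro I hI
    have : maximalIdeal R ≤ I := by
      rw [hz, Ideal.span_singleton_le_iff_mem]
      exact hI.mem_of_pow_mem 2 (h0 ▸ I.zero_mem)
    rw [← (maximalIdeal.isMaximal R).eq_of_le hI.ne_top this]
    exact maximalIdeal.isMaximal R
  exact Order.krullDimLE_iff 0 _ |>.mp this

/-- In a regular local ring with regular system of parameters `z`, the square of a parameter `z p`
is nonzero in the degree two part of the associated graded ring modulo the other parameters. -/
theorem IsLocalRing.mem_maximalIdeal_of_mul_sq_mem {S : Type*} [CommRing S] [IsLocalRing S]
    [IsNoetherianRing S] {ι : Type*} [Fintype ι] {z : ι → S}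
    (hz : Ideal.span (Set.range z) = maximalIdeal S)
    (hdim : (Fintype.card ι : WithBot ℕ∞) ≤ ringKrullDim S) {p : ι} {a : S}
    (ha : a * z p ^ 2 ∈ maximalIdeal S ^ 3 ⊔ Ideal.span (z '' {p}ᶜ)) : a ∈ maximalIdeal S := by
  classical
  -- If `a` were a unit, `S ⧸ J` would have a principal maximal ideal whose generator has its square
  -- in the cube of that ideal, hence dimension zero. Killing only `card ι - 1` elements must leave
  -- dimension at least one.
  by_contra hau
  rw [IsLocalRing.notMem_maximalIdeal] at hau
  set J := Ideal.span (z '' {p}ᶜ) with hJ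
  rw [Ideal.unit_mul_mem_iff_mem _ hau] at ha
  have hzm (i : ι) : z i ∈ maximalIdeal S := hz ▸ Ideal.subset_span ⟨i, rfl⟩
  have hJm : J ≤ maximalIdeal S := by
    rw [hJ, Ideal.span_le]
    rintro _ ⟨i, -, rfl⟩
    exact hzm i
  have : Nontrivial (S ⧸ J) :=
    Ideal.Quotient.nontrivial_iff.mpr fun h => (maximalIdeal.isMaximal S).ne_top (top_le_iff.mp (h ▸ hJm))
  have : IsLocalRing (S ⧸ J) := .of_surjective' _ Ideal.Quotient.mk_surjective
  have hmap : (maximalIdeal S).map (Ideal.Quotient.mk J) = maximalIdeal (S ⧸ J) :=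
    IsLocalRing.map_maximalIdeal_of_surjective _ Ideal.Quotient.mk_surjective
  have hz' : maximalIdeal (S ⧸ J) = Ideal.span {Ideal.Quotient.mk J (z p)} := by
    rw [← hmap, ← hz, Ideal.map_span]
    refine le_antisymm (Ideal.span_le.mpr ?_) (Ideal.span_mono ?_)
    · rintro _ ⟨_, ⟨i, rfl⟩, rfl⟩
      by_cases hi : i = p
      · subst hi
        exact Ideal.mem_span_singleton_self _
      · have : Ideal.Quotient.mk J (z i) = 0 :=
          Ideal.Quotient.eq_zero_iff_mem.mpr (Ideal.subset_span ⟨i, hi, rfl⟩)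
        rw [this]
        exact Ideal.zero_mem _
    · rintro _ rfl
      exact ⟨_, ⟨p, rfl⟩, rfl⟩
  have h1 := ringKrullDim_le_zero_of_span_singleton hz' (by
    have := Ideal.mem_map_of_mem (Ideal.Quotient.mk J) ha
    rwa [Ideal.map_sup, Ideal.map_quotient_self, sup_bot_eq, Ideal.map_pow, hmap, map_pow] at this)
  have h2 := ringKrullDim_le_ringKrullDim_quotient_add_card (R := S)
    (s := (Finset.univ.erase p).image z) (by
      rw [IsLocalRing.ringJacobson_eq_maximalIdeal]
      intro x hx
      obtain ⟨i, -, rfl⟩ := by simpa using hx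
      exact hzm i)
  have h3 : ((Finset.univ.erase p).image z : Set S) = z '' {p}ᶜ := by
    ext; simp
  rw [h3, ← hJ] at h2
  have h4 : ((Finset.univ.erase p).image z).card + 1 ≤ Fintype.card ι := by
    have := Finset.card_image_le (s := Finset.univ.erase p) (f := z)
    rw [Finset.card_erase_of_mem (Finset.mem_univ _), Finset.card_univ] at this
    have : 0 < Fintype.card ι := Fintype.card_pos_iff.mpr ⟨p⟩
    lia
  have h5 : (Fintype.card ι : WithBot ℕ∞) ≤ (((Finset.univ.erase p).image z).card : ℕ) :=
    hdim.trans (h2.trans (by simpa using add_le_add_left h1 _))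
  have h6 : Fintype.card ι ≤ ((Finset.univ.erase p).image z).card := by exact_mod_cast h5
  lia

/-- Dropping one of the minimal generators from a presentation by a regular local ring. -/
theorem IsLocalRing.exists_quotient_presentation {S : Type u} [CommRing S] [IsLocalRing S]
    [IsNoetherianRing S] {N : ℕ} {u : Fin N → S} (hu : Ideal.span (Set.range u) = maximalIdeal S)
    (hdim : (N : WithBot ℕ∞) ≤ ringKrullDim S) {x : S} (hx : x ∈ maximalIdeal S)
    (hx2 : x ∉ maximalIdeal S ^ 2) :
    ∃ (_ : IsLocalRing (S ⧸ Ideal.span {x})) (N' : ℕ) (u' : Fin N' → S ⧸ Ideal.span {x}),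
      N = N' + 1 ∧ Ideal.span (Set.range u') = maximalIdeal (S ⧸ Ideal.span {x}) ∧
      (N' : WithBot ℕ∞) ≤ ringKrullDim (S ⧸ Ideal.span {x}) := by
  set J := Ideal.span {x} with hJ
  have hJm : J ≤ maximalIdeal S := by rwa [hJ, Ideal.span_singleton_le_iff_mem]
  have : Nontrivial (S ⧸ J) :=
    Ideal.Quotient.nontrivial_iff.mpr fun h => (maximalIdeal.isMaximal S).ne_top (top_le_iff.mp (h ▸ hJm))
  have hloc : IsLocalRing (S ⧸ J) := .of_surjective' _ Ideal.Quotient.mk_surjective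
  have hmap : (maximalIdeal S).map (Ideal.Quotient.mk J) = maximalIdeal (S ⧸ J) :=
    IsLocalRing.map_maximalIdeal_of_surjective _ Ideal.Quotient.mk_surjective
  have hum (i) : u i ∈ maximalIdeal S := hu ▸ Ideal.subset_span ⟨i, rfl⟩
  obtain ⟨a, ha⟩ := Ideal.mem_span_range_iff_exists_fun.mp (hu ▸ hx)
  -- As `x` is outside the square of the maximal ideal, some coefficient is a unit; modulo `x` the
  -- corresponding generator is redundant.
  obtain ⟨i, hi⟩ : ∃ i, IsUnit (a i) := by
    by_contra! h
    apply hx2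
    rw [← ha, pow_two]
    exact Ideal.sum_mem _ fun i _ => Ideal.mul_mem_mul ((IsLocalRing.mem_maximalIdeal _).mpr (h i)) (hum i)
  obtain ⟨N, rfl⟩ : ∃ M, N = M + 1 := ⟨N - 1, by have := i.pos; lia⟩
  refine ⟨hloc, N, fun j => Ideal.Quotient.mk J (u (i.succAbove j)), rfl, ?_, ?_⟩
  · rw [← hmap, ← hu, Ideal.map_span]
    refine le_antisymm (Ideal.span_mono ?_) (Ideal.span_le.mpr ?_)
    · rintro _ ⟨j, rfl⟩
      exact ⟨_, ⟨_, rfl⟩, rfl⟩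
    · rintro _ ⟨_, ⟨j, rfl⟩, rfl⟩
      obtain rfl | ⟨j, rfl⟩ := Fin.eq_self_or_eq_succAbove i j
      · have h0 : Ideal.Quotient.mk J (∑ k, a k * u k) = 0 := by
          rw [ha]
          exact Ideal.Quotient.eq_zero_iff_mem.mpr (Ideal.mem_span_singleton_self x)
        rw [Fin.sum_univ_succAbove _ j, map_add, map_mul, map_sum] at h0
        have h1 := (hi.map (Ideal.Quotient.mk J))
        rw [SetLike.mem_coe, ← Ideal.unit_mul_mem_iff_mem _ h1, eq_neg_of_add_eq_zero_left h0]
        refine neg_mem (Ideal.sum_mem _ fun k _ => ?_)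
        rw [map_mul]
        exact Ideal.mul_mem_left _ _ (Ideal.subset_span ⟨k, rfl⟩)
      · exact Ideal.subset_span ⟨j, rfl⟩
  · have h2 := ringKrullDim_le_ringKrullDim_quotient_add_card (R := S) (s := {x}) (by
      rw [IsLocalRing.ringJacobson_eq_maximalIdeal]
      simpa using hx)
    rw [Finset.coe_singleton, ← hJ] at h2
    have h3 := hdim.trans h2
    rw [Finset.card_singleton, Nat.cast_add] at h3
    exact (ENat.WithBot.add_le_add_natCast_right_iff).mp h3

/-- More than `c` vectors in `k^c` are linearly dependent; lift such a dependence from the residue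
field. -/
theorem IsLocalRing.exists_sum_mul_mem_maximalIdeal {S : Type*} [CommRing S] [IsLocalRing S]
    {K : Type*} [Fintype K] {c : ℕ} (hc : c < Fintype.card K) (A : K → Fin c → S) :
    ∃ a : K → S, (∃ k, IsUnit (a k)) ∧ ∀ l, ∑ k, a k * A k l ∈ maximalIdeal S := by
  have h1 : ¬ LinearIndependent (ResidueField S) fun k l => residue S (A k l) := fun h => by
    have := h.fintype_card_le_finrank
    rw [Module.finrank_fin_fun] at this
    lia
  rw [Fintype.not_linearIndependent_iff] at h1
  obtain ⟨b, hb, k, hk⟩ := h1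
  choose a ha using fun k => residue_surjective (b k)
  refine ⟨a, ⟨k, ?_⟩, fun l => ?_⟩
  · rw [← IsLocalRing.residue_ne_zero_iff_isUnit, ha]
    exact hk
  · rw [← residue_eq_zero_iff, map_sum]
    simpa [ha] using congrFun hb l

/-- A local ring whose maximal ideal is minimally generated by elements `y s(i, j)`, `i, j < n`,
`3 ≤ n`, with the relations `y s(i, j) * y s(i, k) = y s(i, i) * y s(j, k)`, is not the quotient of
a regular local ring of dimension `N` by `N - n` elements contained in the square of the maximal
ideal. -/
theorem IsLocalRing.false_of_presentation_of_mem_sq {B : Type u} [CommRing B] [IsLocalRing B]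
    {n : ℕ} (hn : 3 ≤ n) {y : Sym2 (Fin n) → B} (hy : Ideal.span (Set.range y) = maximalIdeal B)
    (hrel : ∀ i j k, y s(i, j) * y s(i, k) = y s(i, i) * y s(j, k))
    {S : Type u} [CommRing S] [IsLocalRing S] [IsNoetherianRing S] {c N : ℕ}
    (hN : Fintype.card (Sym2 (Fin n)) ≤ N) (hdim : (N : WithBot ℕ∞) ≤ ringKrullDim S)
    {g : Fin c → S} {π : S →+* B} (hπ : Function.Surjective π)
    (hker : RingHom.ker π = Ideal.span (Set.range g)) (hcN : c + n ≤ N)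
    (hg : ∀ l, g l ∈ maximalIdeal S ^ 2) : False := by
  classical
  have hloc : IsLocalHom π := hπ.isLocalHom
  have hπm (x : S) : π x ∈ maximalIdeal B ↔ x ∈ maximalIdeal S := by
    rw [IsLocalRing.mem_maximalIdeal, IsLocalRing.mem_maximalIdeal, mem_nonunits_iff,
      mem_nonunits_iff, isUnit_map_iff]
  have hker2 : RingHom.ker π ≤ maximalIdeal S ^ 2 := by
    rw [hker, Ideal.span_le]
    rintro _ ⟨l, rfl⟩
    exact hg l
  choose z hz using fun s => hπ (y s)
  have hzm (s) : z s ∈ maximalIdeal S := by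
    rw [← hπm, hz, ← hy]
    exact Ideal.subset_span ⟨s, rfl⟩
  have hzspan : Ideal.span (Set.range z) = maximalIdeal S := by
    refine le_antisymm (Ideal.span_le.mpr (Set.range_subset_iff.mpr hzm)) ?_
    -- Nakayama: lifts of the generators of `B` generate modulo `ker π`, which lies in the square of
    -- the maximal ideal.
    refine Submodule.le_of_le_smul_of_le_jacobson_bot (I := maximalIdeal S)
      (IsNoetherian.noetherian _) (IsLocalRing.jacobson_eq_maximalIdeal ⊥ bot_ne_top).ge ?_
    intro x hx
    obtain ⟨b, hb⟩ := Ideal.mem_span_range_iff_exists_fun.mp (hy ▸ (hπm x).mpr hx)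
    choose β hβ using fun s => hπ (b s)
    rw [← sub_add_cancel x (∑ s, β s * z s), add_comm]
    refine Submodule.add_mem_sup (Ideal.sum_mem _ fun s _ => Ideal.mul_mem_left _ _
      (Ideal.subset_span ⟨s, rfl⟩)) ?_
    rw [smul_eq_mul, ← pow_two]
    apply hker2
    rw [RingHom.mem_ker, map_sub, map_sum, ← hb]
    simp [hβ, hz]
  have hdim' : (Fintype.card (Sym2 (Fin n)) : WithBot ℕ∞) ≤ ringKrullDim S :=
    (Nat.cast_le.mpr hN).trans hdim
  have hN2 : N ≤ Fintype.card (Sym2 (Fin n)) := by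
    have h1 := hdim.trans (ringKrullDim_le_spanFinrank_maximalIdeal S)
    have h2 := Submodule.spanFinrank_span_le_ncard_of_finite (R := S) (Set.finite_range z)
    rw [← Ideal.span, hzspan, Set.ncard_eq_toFinset_card', Set.toFinset_range] at h2
    have h3 : N ≤ (maximalIdeal S).spanFinrank := by exact_mod_cast h1
    exact h3.trans (h2.trans (Finset.card_image_le.trans Finset.card_univ.le))
  let i₀ : Fin n := ⟨0, by lia⟩
  let i₁ : Fin n := ⟨1, by lia⟩
  let i₂ : Fin n := ⟨2, by lia⟩
  have h01 : i₀ ≠ i₁ := by simp [i₀, i₁]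
  have h02 : i₀ ≠ i₂ := by simp [i₀, i₂]
  have h12 : i₁ ≠ i₂ := by simp [i₁, i₂]
  have hne012 : s(i₀, i₁) ≠ s(i₀, i₂) := by
    simp [h12, h02]
  let D : Sym2 (Fin n) → S := Sym2.lift ⟨fun i j => z s(i, i) * z s(j, j), fun i j => mul_comm _ _⟩
  -- There are `n(n-1)/2` relations `z_ij² - z_ii z_jj` with `i ≠ j`, and `none` indexes the extra
  -- one `z₀₁z₀₂ - z₀₀z₁₂`. The bounds on `N` leave only `c ≤ n(n-1)/2` generators of the kernel.
  let rel : Option {s : Sym2 (Fin n) // ¬ s.IsDiag} → S := fun o =>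
    o.elim (z s(i₀, i₁) * z s(i₀, i₂) - z s(i₀, i₀) * z s(i₁, i₂)) fun s => z s ^ 2 - D s
  have hrel1 (o) : rel o ∈ RingHom.ker π := by
    obtain _ | ⟨s, hs⟩ := o
    · simp only [rel, Option.elim_none, RingHom.mem_ker, map_sub, map_mul, hz]
      exact sub_eq_zero.mpr (hrel _ _ _)
    · induction s with | _ i j
      simp only [rel, Option.elim_some, RingHom.mem_ker, map_sub, map_mul, hz, D,
        Sym2.lift_mk, pow_two]
      exact sub_eq_zero.mpr (hrel _ _ _)
  have hcard : c < Fintype.card (Option {s : Sym2 (Fin n) // ¬ s.IsDiag}) := by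
    rw [Fintype.card_option, Sym2.card_subtype_not_diag, Fintype.card_fin]
    rw [Sym2.card, Fintype.card_fin, Nat.choose_succ_succ' n 1, Nat.choose_one_right] at hN2
    lia
  choose A hA using fun o => Ideal.mem_span_range_iff_exists_fun.mp (hker ▸ hrel1 o)
  obtain ⟨a, ⟨k, hk⟩, ha⟩ := exists_sum_mul_mem_maximalIdeal hcard A
  -- By the choice of `a`, this combination has coefficients in the maximal ideal with respect to
  -- the `g l`, which themselves lie in its square.
  have hT : ∑ o, a o * rel o ∈ maximalIdeal S ^ 3 := by
    have : ∑ o, a o * rel o = ∑ l, (∑ o, a o * A o l) * g l := by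
      simp_rw [← hA, Finset.mul_sum, Finset.sum_mul]
      rw [Finset.sum_comm]
      simp_rw [mul_assoc]
    rw [this, pow_succ']
    exact Ideal.sum_mem _ fun l _ => Ideal.mul_mem_mul (ha l) (hg l)
  rw [Fintype.sum_option] at hT
  have hdiag {s : Sym2 (Fin n)} (hs : ¬ s.IsDiag) (i) : s(i, i) ≠ s := by
    rintro rfl
    exact hs (Sym2.mk_isDiag_iff.mpr rfl)
  have hD {J : Ideal S} (hJ : ∀ i, z s(i, i) ∈ J) (s) : D s ∈ J := by
    induction s with | _ i j
    exact Ideal.mul_mem_right _ _ (hJ i)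
  -- Setting every `z s` with `s ≠ p` to zero leaves only `a_p z_p²`: diagonal variables vanish, and
  -- so does one of `z₀₁`, `z₀₂`, which kills the extra relation.
  have hsome (p : {s : Sym2 (Fin n) // ¬ s.IsDiag}) : a (some p) ∈ maximalIdeal S := by
    refine mem_maximalIdeal_of_mul_sq_mem hzspan hdim' (p := p.1) ?_
    set J := Ideal.span (z '' {p.1}ᶜ) with hJ
    have hzJ (s) (hs : s ≠ p.1) : z s ∈ J := Ideal.subset_span ⟨s, hs, rfl⟩
    have hnone : rel none ∈ J := by
      refine sub_mem ?_ (Ideal.mul_mem_right _ _ (hzJ _ (hdiag p.2 _)))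
      by_cases h : s(i₀, i₁) = p.1
      · refine Ideal.mul_mem_left _ _ (hzJ _ fun h' => ?_)
        exact hne012 (h.trans h'.symm)
      · exact Ideal.mul_mem_right _ _ (hzJ _ h)
    have hmain : a (some p) * z p.1 ^ 2 - (a none * rel none + ∑ s, a (some s) * rel (some s)) ∈ J := by
      rw [← Finset.add_sum_erase _ _ (Finset.mem_univ p)]
      have : a (some p) * z p.1 ^ 2 - (a none * rel none + (a (some p) * rel (some p) +
          ∑ s ∈ Finset.univ.erase p, a (some s) * rel (some s))) = a (some p) * D p.1 -
          a none * rel none - ∑ s ∈ Finset.univ.erase p, a (some s) * rel (some s) := by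
        simp only [rel, Option.elim_some]
        ring
      rw [this]
      refine sub_mem (sub_mem (Ideal.mul_mem_left _ _ (hD (fun i => hzJ _ (hdiag p.2 i)) _))
        (Ideal.mul_mem_left _ _ hnone)) (Ideal.sum_mem _ fun s hs => Ideal.mul_mem_left _ _ ?_)
      refine sub_mem (Ideal.pow_mem_of_mem _ (hzJ _ fun h => ?_) 2 two_pos)
        (hD (fun i => hzJ _ (hdiag p.2 i)) _)
      exact Finset.ne_of_mem_erase hs (Subtype.ext h)
    have := Ideal.add_mem _ (Ideal.mem_sup_right (S := maximalIdeal S ^ 3) (T := J) hmain)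
      (Ideal.mem_sup_left hT)
    rwa [sub_add_cancel] at this
  have hnone : a none ∈ maximalIdeal S := by
    -- Replacing `z₀₂` by `z₀₂ - z₀₁` in the system of parameters turns the extra relation into
    -- `z₀₁²` modulo the other parameters.
    let z' := Function.update z s(i₀, i₂) (z s(i₀, i₂) - z s(i₀, i₁))
    have hz'1 (s) (hs : s ≠ s(i₀, i₂)) : z' s = z s := Function.update_of_ne hs _ _
    have hz'2 : z' s(i₀, i₂) = z s(i₀, i₂) - z s(i₀, i₁) := Function.update_self _ _ _
    have hz'span : Ideal.span (Set.range z') = maximalIdeal S := by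
      rw [← hzspan]
      refine le_antisymm (Ideal.span_le.mpr ?_) (Ideal.span_le.mpr ?_)
      · rintro _ ⟨s, rfl⟩
        by_cases hs : s = s(i₀, i₂)
        · rw [hs, hz'2]
          exact sub_mem (Ideal.subset_span ⟨_, rfl⟩) (Ideal.subset_span ⟨_, rfl⟩)
        · rw [hz'1 s hs]
          exact Ideal.subset_span ⟨_, rfl⟩
      · rintro _ ⟨s, rfl⟩
        by_cases hs : s = s(i₀, i₂)
        · rw [hs, ← sub_add_cancel (z s(i₀, i₂)) (z s(i₀, i₁)), ← hz'2, ← hz'1 _ hne012]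
          exact add_mem (Ideal.subset_span ⟨_, rfl⟩) (Ideal.subset_span ⟨_, rfl⟩)
        · rw [← hz'1 s hs]
          exact Ideal.subset_span ⟨_, rfl⟩
    refine mem_maximalIdeal_of_mul_sq_mem hz'span hdim' (p := s(i₀, i₁)) ?_
    set J := Ideal.span (z' '' {s(i₀, i₁)}ᶜ) with hJ
    have h1 : z s(i₀, i₂) - z s(i₀, i₁) ∈ J := hz'2 ▸ Ideal.subset_span ⟨_, hne012.symm, rfl⟩
    have h2 : z s(i₀, i₀) ∈ J := by
      rw [← hz'1 s(i₀, i₀) (by simpa using h02)]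
      exact Ideal.subset_span ⟨_, by simpa using h01, rfl⟩
    have h3 : ∑ s, a (some s) * rel (some s) ∈ maximalIdeal S ^ 3 := by
      rw [pow_succ']
      exact Ideal.sum_mem _ fun s _ => Ideal.mul_mem_mul (hsome s) (hker2 (hrel1 _))
    have h4 : a none * rel none ∈ maximalIdeal S ^ 3 := by
      have := sub_mem hT h3
      rwa [add_sub_cancel_right] at this
    have h5 : a none * z' s(i₀, i₁) ^ 2 - a none * rel none ∈ J := by
      rw [hz'1 _ hne012]
      have : a none * z s(i₀, i₁) ^ 2 - a none * rel none =
          a none * z s(i₁, i₂) * z s(i₀, i₀) - a none * z s(i₀, i₁) *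
          (z s(i₀, i₂) - z s(i₀, i₁)) := by
        simp only [rel, Option.elim_none]
        ring
      rw [this]
      exact sub_mem (Ideal.mul_mem_left _ _ h2) (Ideal.mul_mem_left _ _ h1)
    have := Ideal.add_mem _ (Ideal.mem_sup_right (S := maximalIdeal S ^ 3) (T := J) h5)
      (Ideal.mem_sup_left h4)
    rwa [sub_add_cancel] at this
  obtain _ | p := k
  · exact (IsLocalRing.mem_maximalIdeal _).mp hnone hk
  · exact (IsLocalRing.mem_maximalIdeal _).mp (hsome p) hk

/-- A relation outside the square of the maximal ideal is part of a minimal generating set; dividing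
it out lowers `c` and `N` together and keeps `c + n ≤ N`. This ends with all relations in the
square. -/
theorem IsLocalRing.false_of_presentation {B : Type u} [CommRing B] [IsLocalRing B]
    {n : ℕ} (hn : 3 ≤ n) {y : Sym2 (Fin n) → B} (hy : Ideal.span (Set.range y) = maximalIdeal B)
    (hmin : ∀ (N : ℕ) (u : Fin N → B), Ideal.span (Set.range u) = maximalIdeal B →
      Fintype.card (Sym2 (Fin n)) ≤ N)
    (hrel : ∀ i j k, y s(i, j) * y s(i, k) = y s(i, i) * y s(j, k))
    {c N : ℕ} {S : Type u} [CommRing S] [IsLocalRing S] [IsNoetherianRing S]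
    {u : Fin N → S} (hu : Ideal.span (Set.range u) = maximalIdeal S)
    (hdim : (N : WithBot ℕ∞) ≤ ringKrullDim S) {g : Fin c → S} {π : S →+* B}
    (hπ : Function.Surjective π) (hker : RingHom.ker π = Ideal.span (Set.range g))
    (hcN : c + n ≤ N) : False := by
  induction c generalizing N S with
  | zero =>
    refine false_of_presentation_of_mem_sq hn hy hrel (hmin N (π ∘ u) ?_) hdim hπ hker hcN
      fun l => l.elim0
    rw [Set.range_comp, ← Ideal.map_span, hu]
    exact IsLocalRing.map_maximalIdeal_of_surjective _ hπ
  | succ c ih =>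
    by_cases hg : ∀ l, g l ∈ maximalIdeal S ^ 2
    · refine false_of_presentation_of_mem_sq hn hy hrel (hmin N (π ∘ u) ?_) hdim hπ hker hcN hg
      rw [Set.range_comp, ← Ideal.map_span, hu]
      exact IsLocalRing.map_maximalIdeal_of_surjective _ hπ
    push Not at hg
    obtain ⟨l, hl⟩ := hg
    have hgl : g l ∈ RingHom.ker π := hker ▸ Ideal.subset_span ⟨l, rfl⟩
    have hlm : g l ∈ maximalIdeal S :=
      IsLocalRing.le_maximalIdeal (RingHom.ker_ne_top π) hgl
    obtain ⟨hloc, N', u', rfl, hu', hdim'⟩ := exists_quotient_presentation hu hdim hlm hl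
    let π' : S ⧸ Ideal.span {g l} →+* B := Ideal.Quotient.lift _ π fun a ha => by
      rw [← RingHom.mem_ker]
      exact (Ideal.span_singleton_le_iff_mem _).mpr hgl ha
    refine ih hu' hdim' (g := fun j => Ideal.Quotient.mk _ (g (l.succAbove j))) (π := π')
      (Ideal.Quotient.lift_surjective_of_surjective _ _ hπ) ?_ (by lia)
    refine (Ideal.ker_quotient_lift _ _).trans ?_
    rw [hker, Ideal.map_span]
    refine le_antisymm (Ideal.span_le.mpr ?_) (Ideal.span_mono ?_)
    · rintro _ ⟨_, ⟨j, rfl⟩, rfl⟩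
      obtain rfl | ⟨j, rfl⟩ := Fin.eq_self_or_eq_succAbove l j
      · rw [Ideal.Quotient.eq_zero_iff_mem.mpr (Ideal.mem_span_singleton_self (g j))]
        exact Ideal.zero_mem _
      · exact Ideal.subset_span ⟨j, rfl⟩
    · rintro _ ⟨j, rfl⟩
      exact ⟨_, ⟨_, rfl⟩, rfl⟩

end Presentations

/-! ### Division of power series by monomials. -/

namespace MvPowerSeries

open Finsupp

section Division

variable {σ E : Type*} [CommRing E]

/-- Assign each monomial of `f` to one chosen `i` with `s i ≤ m`. No cancellation occurs, so by the
second conclusion parity and degree conditions on `f` pass to the cofactors. -/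
lemma exists_eq_sum_monomial_mul {ι : Type*} [Fintype ι] (s : ι → σ →₀ ℕ)
    (f : MvPowerSeries σ E) (hf : ∀ m, coeff m f ≠ 0 → ∃ i, s i ≤ m) :
    ∃ g : ι → MvPowerSeries σ E, f = ∑ i, monomial (s i) 1 * g i ∧
      ∀ i m, coeff m (g i) ≠ 0 → coeff (m + s i) f ≠ 0 := by
  classical
  choose c hc using hf
  let g : ι → MvPowerSeries σ E := fun i m =>
    if h : coeff (m + s i) f ≠ 0 then if c _ h = i then coeff (m + s i) f else 0 else 0
  have hg (i m) : coeff m (g i) =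
    if h : coeff (m + s i) f ≠ 0 then if c _ h = i then coeff (m + s i) f else 0 else 0 := rfl
  refine ⟨g, ?_, fun i m h h' => h (by rw [hg, dif_neg (not_not.mpr h')])⟩
  ext m
  simp only [map_sum, coeff_monomial_mul, one_mul]
  have key (i) (hi : s i ≤ m) : coeff (m - s i) (g i) =
      if h : coeff m f ≠ 0 then if c _ h = i then coeff m f else 0 else 0 := by
    have := hg i (m - s i)
    simpa only [tsub_add_cancel_of_le hi] using this
  by_cases h : coeff m f ≠ 0
  · rw [Finset.sum_eq_single (c m h) (fun i _ hi => ?_) (by simp)]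
    · rw [if_pos (hc m h), key _ (hc m h), dif_pos h, if_pos rfl]
    · split_ifs with h'
      · rw [key _ h', dif_pos h, if_neg (Ne.symm hi)]
      · rfl
  · rw [Finset.sum_eq_zero, not_not.mp h]
    intro i _
    split_ifs with h'
    · rw [key _ h', dif_neg h]
    · rfl

variable {R M : Type*} [CommRing R] [AddCommGroup M] [Module R M]
  {θ : M →+ MvPowerSeries σ E} {T : Set (σ →₀ ℕ)} {d : ℕ} {x : σ → R}

/-- `θ` identifies `M` with the series supported in `T`, on which `x i` acts as the `d`-th power of
a variable. As `T` allows that power to be divided out, cofactors stay in `M`. The uses are `T`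
everything with `d = 1`, and `T` a parity class with `d = 2`. -/
lemma mem_span_smul_top_iff (hθ : Function.Injective θ)
    (hrange : ∀ f, (∀ m, coeff m f ≠ 0 → m ∈ T) → f ∈ Set.range θ)
    (hT' : ∀ v m, coeff m (θ v) ≠ 0 → m ∈ T)
    (hT : ∀ m i, m + single i d ∈ T → m ∈ T)
    (hx : ∀ i v, θ (x i • v) = monomial (single i d) 1 * θ v) (S : Finset σ) (v : M) :
    v ∈ (Ideal.span (x '' S) • ⊤ : Submodule R M) ↔
      ∀ m : σ →₀ ℕ, (∀ i ∈ S, m i < d) → coeff m (θ v) = 0 := by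
  constructor
  · intro hv m hm
    induction hv using Submodule.smul_induction_on' with
    | add v _ w _ hv hw => rw [map_add, map_add, hv, hw, add_zero]
    | smul r hr v _ =>
    induction hr using Submodule.span_induction generalizing v with
    | zero => simp
    | add a b _ _ ha hb => rw [add_smul, map_add, map_add, ha v trivial, hb v trivial, add_zero]
    | smul a r _ hr => rw [smul_eq_mul, mul_comm, mul_smul, hr _ trivial]
    | mem _ hr =>
      obtain ⟨i, hi, rfl⟩ := hr
      rw [hx, coeff_monomial_mul, if_neg]
      intro h
      have := h i
      rw [single_eq_same] at this
      exact (hm i hi).not_ge this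
  · intro h
    obtain ⟨g, hg, hg'⟩ := exists_eq_sum_monomial_mul (fun i : S => single (i : σ) d) (θ v) (by
      intro m hm
      by_contra! hcon
      refine hm (h m fun i hi => ?_)
      by_contra! hle
      exact hcon ⟨i, hi⟩ (single_le_iff.mpr hle))
    have hgθ (i : S) : g i ∈ Set.range θ :=
      hrange _ fun m hm => hT m i (hT' v _ (hg' i m hm))
    choose w hw using hgθ
    have : v = ∑ i : S, x i • w i := by
      apply hθ
      rw [map_sum, hg]
      simp only [hx, hw]
    rw [this]
    exact Submodule.sum_mem _ fun i _ => Submodule.smul_mem_smul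
      (Ideal.subset_span ⟨i, i.2, rfl⟩) trivial

/-- Membership in the submodule generated by the earlier `x j` only concerns the exponents of
earlier variables, while multiplication by `x i` shifts only the exponent at `i`. -/
lemma isWeaklyRegular_ofFn {n : ℕ} {θ : M →+ MvPowerSeries (Fin n) E} {T : Set (Fin n →₀ ℕ)}
    {x : Fin n → R} (hθ : Function.Injective θ)
    (hrange : ∀ f, (∀ m, coeff m f ≠ 0 → m ∈ T) → f ∈ Set.range θ)
    (hT' : ∀ v m, coeff m (θ v) ≠ 0 → m ∈ T)
    (hT : ∀ m i, m + single i d ∈ T → m ∈ T)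
    (hx : ∀ i v, θ (x i • v) = monomial (single i d) 1 * θ v) :
    RingTheory.Sequence.IsWeaklyRegular M (List.ofFn x) := by
  refine ⟨fun i hi => ?_⟩
  rw [List.length_ofFn] at hi
  have htake : Ideal.ofList ((List.ofFn x).take i) =
      Ideal.span (x '' (Finset.Iio (⟨i, hi⟩ : Fin n))) := by
    rw [Ideal.ofList]
    congr 1
    ext r
    simp only [Set.mem_ofPred_eq, List.mem_take_iff_getElem, List.length_ofFn, List.getElem_ofFn,
      Set.mem_image, Finset.coe_Iio, Set.mem_Iio]
    constructor
    · rintro ⟨j, hj, rfl⟩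
      exact ⟨⟨j, by lia⟩, Fin.mk_lt_mk.mpr (by lia), rfl⟩
    · rintro ⟨j, hj, rfl⟩
      exact ⟨j, lt_min hj j.2, rfl⟩
  rw [isSMulRegular_quotient_iff_mem_of_smul_mem, htake]
  intro v hv
  rw [mem_span_smul_top_iff hθ hrange hT' hT hx] at hv ⊢
  intro m hm
  have := hv (m + single ⟨i, hi⟩ d) fun j hj => by
    rw [Finsupp.add_apply, single_eq_of_ne (Finset.mem_Iio.mp hj).ne, add_zero]
    exact hm j hj
  rwa [List.getElem_ofFn, hx, add_comm, coeff_add_monomial_mul, one_mul] at this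

lemma ofList_ofFn {n : ℕ} (x : Fin n → R) :
    Ideal.ofList (List.ofFn x) = Ideal.span (Set.range x) := by
  rw [Ideal.ofList]
  congr 1
  ext r
  simp [List.mem_ofFn]

end Division

end MvPowerSeries

/-! ### The involution on coefficients. -/

section Invariants

open MvPowerSeries Finsupp

variable (E : Type u) [Field E] (n : ℕ)

lemma coeff_negVars (f : MvPowerSeries (Fin n) E) (m : Fin n →₀ ℕ) :
    coeff m (negVars E n f) = (-1) ^ m.degree * coeff m f := by
  change coeff m (rescaleAlgHom _ f) = _
  rw [rescaleAlgHom_apply, coeff_rescale]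
  simp [Finsupp.prod, Finset.prod_pow_eq_pow_sum, Finsupp.degree_apply]

lemma mem_evenInvariants_iff_negVars {f : MvPowerSeries (Fin n) E} :
    f ∈ evenInvariants E n ↔ negVars E n f = f := by
  constructor
  · intro h
    simpa [negAction, ZMod.val_one] using h (Multiplicative.ofAdd 1)
  · rintro h a
    change (negVars E n ^ (Multiplicative.toAdd a).val) f = f
    generalize (Multiplicative.toAdd a).val = k
    induction k with
    | zero => rfl
    | succ k ih => rw [pow_succ, AlgEquiv.mul_apply, h, ih]

end Invariants

/-! ### The invariants form a local domain. -/

section LocalDomain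

open MvPowerSeries

variable {E : Type u} [Field E] {n : ℕ}

instance : IsDomain (evenInvariants E n) :=
  have : IsDomain (MvPowerSeries (Fin n) E) := NoZeroDivisors.to_isDomain _
  inferInstance

/-- The inverse of an invariant unit is invariant, inverses being unique. -/
instance : IsLocalHom (evenInvariants E n).val := by
  refine ⟨fun a ha => ?_⟩
  obtain ⟨b, hb⟩ := isUnit_iff_exists_inv.mp ha
  have ha' : (evenInvariants E n).val a ≠ 0 := ha.ne_zero
  have hbm : b ∈ evenInvariants E n := by
    have h1 := (mem_evenInvariants_iff_negVars E n).mp a.2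
    rw [mem_evenInvariants_iff_negVars]
    refine mul_left_cancel₀ ha' ?_
    have := congrArg (negVars E n) hb
    rw [map_mul, map_one] at this
    rw [hb, ← this]
    exact congrArg (· * _) h1.symm
  exact isUnit_iff_exists_inv.mpr ⟨⟨b, hbm⟩, Subtype.ext hb⟩

instance : IsLocalRing (evenInvariants E n) :=
  have : IsLocalHom (evenInvariants E n).val.toRingHom :=
    ⟨fun a ha => IsLocalHom.map_nonunit (f := (evenInvariants E n).val) a ha⟩
  RingHom.domain_isLocalRing (evenInvariants E n).val.toRingHom

lemma evenInvariants.mem_maximalIdeal_iff {b : evenInvariants E n} :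
    b ∈ maximalIdeal (evenInvariants E n) ↔ constantCoeff (b : MvPowerSeries (Fin n) E) = 0 := by
  rw [IsLocalRing.mem_maximalIdeal, mem_nonunits_iff,
    ← isUnit_map_iff (evenInvariants E n).val b, isUnit_iff_constantCoeff, isUnit_iff_ne_zero,
    not_not]
  rfl

end LocalDomain

/-! ### Even and odd power series. -/

section Invariants

open MvPowerSeries Finsupp

variable (E : Type u) [Field E] (n : ℕ)

variable {n} in
/-- The exponents of parity `p`. -/
def parityExponents (p : ZMod 2) : Set (Fin n →₀ ℕ) := {m | (m.degree : ZMod 2) = p}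

variable [CharZero E]

/-- A coefficient of odd degree of an invariant equals its own negative, so it vanishes in
characteristic zero. -/
lemma mem_evenInvariants_iff {f : MvPowerSeries (Fin n) E} :
    f ∈ evenInvariants E n ↔ ∀ m, coeff m f ≠ 0 → m ∈ parityExponents 0 := by
  rw [mem_evenInvariants_iff_negVars, MvPowerSeries.ext_iff]
  refine forall_congr' fun m => ?_
  rw [coeff_negVars, parityExponents, Set.mem_ofPred_eq, ZMod.natCast_eq_zero_iff_even]
  obtain h | h := Nat.even_or_odd m.degree
  · simp [h]
  · simp [h.neg_one_pow, Nat.not_even_iff_odd.mpr h, neg_eq_self]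

/-- The power series all of whose monomials have degree of parity `p`, as a module over the
ring of invariants. -/
def parityPart (p : ZMod 2) : Submodule (evenInvariants E n) (MvPowerSeries (Fin n) E) where
  carrier := {f | ∀ m, coeff m f ≠ 0 → m ∈ parityExponents p}
  zero_mem' m h := (h (coeff_zero m)).elim
  add_mem' {f g} hf hg m h := by
    rw [map_add] at h
    by_cases hf' : coeff m f = 0
    · rw [hf', zero_add] at h
      exact hg m h
    · exact hf m hf'
  smul_mem' := by
    classical
    rintro ⟨b, hb⟩ f hf m h
    rw [Subalgebra.smul_def, smul_eq_mul, coeff_mul] at h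
    obtain ⟨⟨i, j⟩, hij, hne⟩ := Finset.exists_ne_zero_of_sum_ne_zero h
    have hi := (mem_evenInvariants_iff E n).mp hb i (left_ne_zero_of_mul hne)
    have hj := hf j (right_ne_zero_of_mul hne)
    rw [Finset.HasAntidiagonal.mem_antidiagonal] at hij
    simp only [parityExponents, Set.mem_ofPred_eq] at hi hj ⊢
    rw [← hij, map_add, Nat.cast_add, hi, hj, zero_add]

variable {E n}

lemma mem_parityPart_iff {p : ZMod 2} {f : MvPowerSeries (Fin n) E} :
    f ∈ parityPart E n p ↔ ∀ m, coeff m f ≠ 0 → m ∈ parityExponents p := Iff.rfl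

lemma mem_evenInvariants_iff_mem_parityPart {f : MvPowerSeries (Fin n) E} :
    f ∈ evenInvariants E n ↔ f ∈ parityPart E n 0 := mem_evenInvariants_iff E n

lemma mul_mem_parityPart {p q : ZMod 2} {f g : MvPowerSeries (Fin n) E}
    (hf : f ∈ parityPart E n p) (hg : g ∈ parityPart E n q) : f * g ∈ parityPart E n (p + q) := by
  classical
  intro m h
  rw [coeff_mul] at h
  obtain ⟨⟨i, j⟩, hij, hne⟩ := Finset.exists_ne_zero_of_sum_ne_zero h
  have hi := hf i (left_ne_zero_of_mul hne)
  have hj := hg j (right_ne_zero_of_mul hne)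
  rw [Finset.HasAntidiagonal.mem_antidiagonal] at hij
  simp only [parityExponents, Set.mem_ofPred_eq] at hi hj ⊢
  rw [← hij, map_add, Nat.cast_add, hi, hj]

lemma monomial_mem_parityPart {p : ZMod 2} {m : Fin n →₀ ℕ} (hm : m ∈ parityExponents p) (a : E) :
    monomial m a ∈ parityPart E n p := fun k hk => by
  rwa [eq_of_coeff_monomial_ne_zero hk]

lemma X_mem_parityPart (i : Fin n) : (X i : MvPowerSeries (Fin n) E) ∈ parityPart E n 1 :=
  monomial_mem_parityPart (by simp [parityExponents]) _

lemma add_single_two_mem_parityExponents_iff {p : ZMod 2} {m : Fin n →₀ ℕ} {i : Fin n} :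
    m + single i 2 ∈ parityExponents p ↔ m ∈ parityExponents p := by
  have : ((2 : ℕ) : ZMod 2) = 0 := rfl
  simp only [parityExponents, Set.mem_ofPred_eq, map_add, degree_single, Nat.cast_add, this,
    add_zero]

variable (E) in
/-- The product of two variables, as an element of the ring of invariants. -/
noncomputable def evenInvariants.XX (i j : Fin n) : evenInvariants E n :=
  ⟨X i * X j, mem_evenInvariants_iff_mem_parityPart.mpr
    (mul_mem_parityPart (X_mem_parityPart i) (X_mem_parityPart j))⟩

lemma evenInvariants.coe_XX_self (i : Fin n) :
    (XX E i i : MvPowerSeries (Fin n) E) = monomial (single i 2) 1 := by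
  rw [← X_pow_eq, pow_two]
  rfl

end Invariants

theorem IsRegularLocalRing.of_span_range {R : Type*} [CommRing R] [IsLocalRing R]
    [IsNoetherianRing R] {N : ℕ} {u : Fin N → R} (hu : Ideal.span (Set.range u) = maximalIdeal R)
    (h : (N : WithBot ℕ∞) ≤ ringKrullDim R) : IsRegularLocalRing R := by
  classical
  refine .of_spanFinrank_maximalIdeal_le _ (le_trans (Nat.cast_le.mpr ?_) h)
  rw [← hu]
  refine (Submodule.spanFinrank_span_le_ncard_of_finite (Set.finite_range u)).trans ?_
  rw [Set.ncard_eq_toFinset_card', Set.toFinset_range]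
  exact Finset.card_image_le.trans (by simp)

/-! ### The power series ring is regular. -/

section PowerSeriesRing

open MvPowerSeries Finsupp

variable {E : Type u} [Field E] {n : ℕ}

lemma Finsupp.exists_single_one_le {σ : Type*} {m : σ →₀ ℕ} (hm : m.degree ≠ 0) :
    ∃ i, single i 1 ≤ m := by
  obtain ⟨i, hi⟩ := Finsupp.ne_iff.mp fun h => hm (degree_eq_zero_iff m |>.mpr h)
  exact ⟨i, single_le_iff.mpr (Nat.one_le_iff_ne_zero.mpr hi)⟩

lemma Finsupp.exists_single_add_single_le {σ : Type*} {m : σ →₀ ℕ} (hm : 2 ≤ m.degree) :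
    ∃ i j, single i 1 + single j 1 ≤ m := by
  obtain ⟨i, hi⟩ := exists_single_one_le (m := m) (by lia)
  have h := congrArg degree (tsub_add_cancel_of_le hi)
  rw [map_add, degree_single] at h
  obtain ⟨j, hj⟩ := exists_single_one_le (m := m - single i 1) (by lia)
  exact ⟨i, j, by rw [add_comm, ← le_tsub_iff_right hi]; exact hj⟩

lemma MvPowerSeries.mem_maximalIdeal_iff {σ : Type*} {f : MvPowerSeries σ E} :
    f ∈ maximalIdeal (MvPowerSeries σ E) ↔ constantCoeff f = 0 := by
  rw [IsLocalRing.mem_maximalIdeal, mem_nonunits_iff, isUnit_iff_constantCoeff, isUnit_iff_ne_zero,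
    not_not]

lemma MvPowerSeries.span_range_X :
    Ideal.span (Set.range X) = maximalIdeal (MvPowerSeries (Fin n) E) := by
  refine le_antisymm (Ideal.span_le.mpr ?_) fun f hf => ?_
  · rintro _ ⟨i, rfl⟩
    exact mem_maximalIdeal_iff.mpr (constantCoeff_X i)
  · obtain ⟨g, rfl, -⟩ := exists_eq_sum_monomial_mul (fun i => single i 1) f fun m hm =>
      exists_single_one_le fun h => hm (by
        rw [(degree_eq_zero_iff m).mp h, coeff_zero_eq_constantCoeff]
        exact mem_maximalIdeal_iff.mp hf)
    exact Ideal.sum_mem _ fun i _ => Ideal.mul_mem_right _ _ (Ideal.subset_span ⟨i, rfl⟩)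

lemma MvPowerSeries.isRegular_ofFn_X :
    RingTheory.Sequence.IsRegular (MvPowerSeries (Fin n) E)
      (List.ofFn (X : Fin n → MvPowerSeries (Fin n) E)) := by
  refine .of_isWeaklyRegular_of_mem_maximalIdeal _ (fun r hr => ?_)
    (isWeaklyRegular_ofFn (θ := AddMonoidHom.id _) (T := Set.univ) (d := 1)
      Function.injective_id (fun f _ => ⟨f, rfl⟩) (fun _ _ _ => trivial) (fun _ _ _ => trivial)
      fun i v => rfl)
  rw [← span_range_X]
  exact Ideal.subset_span (by simpa using hr)

lemma MvPowerSeries.isRegularLocalRing : IsRegularLocalRing (MvPowerSeries (Fin n) E) := by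
  have h := ringKrullDim_add_length_eq_ringKrullDim_of_isRegular _
    (isRegular_ofFn_X (E := E) (n := n))
  rw [ofList_ofFn, span_range_X, ringKrullDim_eq_zero_of_isField
    ((Ideal.Quotient.maximal_ideal_iff_isField_quotient _).mp (maximalIdeal.isMaximal _)),
    List.length_ofFn, zero_add] at h
  exact .of_span_range span_range_X h.le

theorem MvPowerSeries.hasInjectiveDimensionLE (M : ModuleCat.{u} (MvPowerSeries (Fin n) E)) :
    HasInjectiveDimensionLE M n := by
  have := ModuleCat.hasInjectiveDimensionLE_of_isRegular (isRegular_ofFn_X (E := E) (n := n))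
    (by rw [ofList_ofFn, span_range_X]) M
  rwa [List.length_ofFn] at this

end PowerSeriesRing

/-! ### Generators of the maximal ideal of the invariants. -/

section Generators

open MvPowerSeries Finsupp

variable {E : Type u} [Field E] [CharZero E] {n : ℕ}

namespace evenInvariants

variable (E) in
/-- The generators of the maximal ideal of the ring of invariants. -/
noncomputable def quadric (s : Sym2 (Fin n)) : evenInvariants E n :=
  Sym2.lift ⟨XX E, fun _ _ => Subtype.ext (mul_comm _ _)⟩ s

lemma quadric_mk (i j : Fin n) : quadric E s(i, j) = XX E i j := rfl

lemma coe_XX (i j : Fin n) :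
    (XX E i j : MvPowerSeries (Fin n) E) = monomial (single i 1 + single j 1) 1 := by
  have := monomial_mul_monomial (single i 1) (single j 1) (1 : E) 1
  rw [one_mul] at this
  exact this

lemma quadric_mul_quadric (i j k : Fin n) :
    quadric E s(i, j) * quadric E s(i, k) = quadric E s(i, i) * quadric E s(j, k) := by
  refine Subtype.ext ?_
  change (X i * X j) * (X i * X k) = (X i * X i) * (X j * X k)
  ring

lemma quadric_mem_maximalIdeal (s : Sym2 (Fin n)) :
    quadric E s ∈ maximalIdeal (evenInvariants E n) := by
  induction s with | _ i j
  rw [mem_maximalIdeal_iff, quadric_mk]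
  change constantCoeff (X i * X j) = 0
  simp

/-- Peel a product of two variables off every monomial: the cofactors remain even and the degree
bound drops by two. -/
lemma mem_span_quadric_pow {k : ℕ} {b : evenInvariants E n}
    (hb : ∀ m, coeff m (b : MvPowerSeries (Fin n) E) ≠ 0 → 2 * k ≤ m.degree) :
    b ∈ Ideal.span (Set.range (quadric E (n := n))) ^ k := by
  induction k generalizing b with
  | zero => simp
  | succ k ih =>
    obtain ⟨g, hg, hg'⟩ := exists_eq_sum_monomial_mul
      (fun p : Fin n × Fin n => single p.1 1 + single p.2 1) (b : MvPowerSeries (Fin n) E)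
      fun m hm => by
        obtain ⟨i, j, h⟩ := exists_single_add_single_le (m := m) (by have := hb m hm; lia)
        exact ⟨(i, j), h⟩
    have hgB (p) : g p ∈ evenInvariants E n := (mem_evenInvariants_iff E n).mpr fun m hm => by
      have := (mem_evenInvariants_iff E n).mp b.2 _ (hg' p m hm)
      rw [parityExponents, Set.mem_ofPred_eq, ZMod.natCast_eq_zero_iff_even] at this ⊢
      simpa [Nat.even_add] using this
    have : b = ∑ p : Fin n × Fin n, quadric E s(p.1, p.2) * ⟨g p, hgB p⟩ := by
      refine Subtype.ext ?_
      rw [hg]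
      simp only [AddSubmonoidClass.coe_finsetSum, MulMemClass.coe_mul, quadric_mk, coe_XX]
    rw [this, pow_succ']
    refine Ideal.sum_mem _ fun p _ => Ideal.mul_mem_mul (Ideal.subset_span ⟨_, rfl⟩)
      (ih fun m hm => ?_)
    have := hb _ (hg' p m hm)
    simp only [map_add, degree_single] at this
    lia

lemma even_degree_of_coeff_ne_zero {b : evenInvariants E n} {m : Fin n →₀ ℕ}
    (h : coeff m (b : MvPowerSeries (Fin n) E) ≠ 0) : Even m.degree :=
  ZMod.natCast_eq_zero_iff_even.mp ((mem_evenInvariants_iff E n).mp b.2 m h)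

lemma two_le_degree_of_coeff_ne_zero {b : evenInvariants E n}
    (hb : b ∈ maximalIdeal (evenInvariants E n)) {m : Fin n →₀ ℕ}
    (h : coeff m (b : MvPowerSeries (Fin n) E) ≠ 0) : 2 ≤ m.degree := by
  obtain ⟨k, hk⟩ := even_degree_of_coeff_ne_zero h
  have : m.degree ≠ 0 := fun h0 => h (by
    rw [(degree_eq_zero_iff m).mp h0, coeff_zero_eq_constantCoeff]
    exact mem_maximalIdeal_iff.mp hb)
  lia

lemma span_range_quadric :
    Ideal.span (Set.range (quadric E)) = maximalIdeal (evenInvariants E n) := by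
  refine le_antisymm (Ideal.span_le.mpr ?_) fun b hb => ?_
  · rintro _ ⟨s, rfl⟩
    exact quadric_mem_maximalIdeal s
  · simpa using mem_span_quadric_pow (k := 1) fun m hm => two_le_degree_of_coeff_ne_zero hb hm

lemma mem_maximalIdeal_pow {k : ℕ} {b : evenInvariants E n}
    (hb : ∀ m, coeff m (b : MvPowerSeries (Fin n) E) ≠ 0 → 2 * k ≤ m.degree) :
    b ∈ maximalIdeal (evenInvariants E n) ^ k :=
  span_range_quadric (E := E) (n := n) ▸ mem_span_quadric_pow hb

/-- The exponent of a product of two variables. -/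
noncomputable def quadricExponent (s : Sym2 (Fin n)) : Fin n →₀ ℕ :=
  Sym2.lift ⟨fun i j => single i 1 + single j 1, fun _ _ => add_comm _ _⟩ s

lemma quadricExponent_injective : Function.Injective (quadricExponent (n := n)) := by
  intro s t h
  induction s with | _ i j
  induction t with | _ k l
  have h' : single i 1 + single j 1 = single k 1 + single l 1 := h
  rw [single_add_single_eq_single_add_single one_ne_zero one_ne_zero] at h'
  rw [Sym2.eq_iff]
  have : ¬ (1 + 1 = 0) := by lia
  tauto

lemma coe_quadric (s : Sym2 (Fin n)) :
    (quadric E s : MvPowerSeries (Fin n) E) = monomial (quadricExponent s) 1 := by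
  induction s with | _ i j
  exact coe_XX i j

lemma degree_quadricExponent (s : Sym2 (Fin n)) : (quadricExponent s).degree = 2 := by
  induction s with | _ i j
  change (single i 1 + single j 1).degree = 2
  simp

/-- On the maximal ideal, taking degree two coefficients is compatible with scalars acting through
their constant terms. Hence any generators map to a spanning family of `E^(Sym2)`, since the
quadrics map to its standard basis. -/
theorem card_sym2_le {N : ℕ} {u : Fin N → evenInvariants E n}
    (hu : Ideal.span (Set.range u) = maximalIdeal (evenInvariants E n)) :
    Fintype.card (Sym2 (Fin n)) ≤ N := by
  classical
  let l : evenInvariants E n → Sym2 (Fin n) → E := fun b s =>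
    coeff (quadricExponent s) (b : MvPowerSeries (Fin n) E)
  have hl (c : evenInvariants E n) {b} (hb : b ∈ maximalIdeal (evenInvariants E n)) :
      l (c * b) = constantCoeff (c : MvPowerSeries (Fin n) E) • l b := by
    ext s
    simp only [l, MulMemClass.coe_mul, coeff_mul, Pi.smul_apply, smul_eq_mul]
    rw [Finset.sum_eq_single ((0, quadricExponent s) : (Fin n →₀ ℕ) × (Fin n →₀ ℕ))]
    · rw [coeff_zero_eq_constantCoeff]
    · rintro ⟨i, j⟩ hij hne
      rw [Finset.HasAntidiagonal.mem_antidiagonal] at hij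
      by_contra h
      have h1 := two_le_degree_of_coeff_ne_zero hb (right_ne_zero_of_mul h)
      have h2 := congrArg degree hij
      simp only [map_add, degree_quadricExponent] at h2 h1
      have : i = 0 := (degree_eq_zero_iff i).mp (by lia)
      rw [this, zero_add] at hij
      exact hne (Prod.ext this hij)
    · intro h
      exact (h (by simp [Finset.HasAntidiagonal.mem_antidiagonal])).elim
  have hspan : Submodule.span E (Set.range fun i => l (u i)) = ⊤ := by
    rw [eq_top_iff, ← (Pi.basisFun E (Sym2 (Fin n))).span_eq, Submodule.span_le]
    rintro _ ⟨s, rfl⟩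
    have h1 : quadric E s ∈ Ideal.span (Set.range u) := hu ▸ quadric_mem_maximalIdeal s
    obtain ⟨c, hc⟩ := Ideal.mem_span_range_iff_exists_fun.mp h1
    have h2 : Pi.basisFun E (Sym2 (Fin n)) s = ∑ i, l (c i * u i) := by
      have : l (quadric E s) = ∑ i, l (c i * u i) := by
        rw [← hc]
        ext t
        simp [l]
      rw [← this]
      ext t
      simp only [Pi.basisFun_apply, l, coe_quadric, coeff_monomial, Pi.single_apply,
        quadricExponent_injective.eq_iff]
    rw [h2]
    refine Submodule.sum_mem _ fun i _ => ?_
    rw [hl _ (hu ▸ Ideal.subset_span ⟨i, rfl⟩)]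
    exact Submodule.smul_mem _ _ (Submodule.subset_span ⟨i, rfl⟩)
  have := finrank_le_of_span_eq_top hspan
  simpa using this

/-- Pigeonhole: monomials of `b ^ (n + 1)` have degree at least `n + 1`, so each is divisible by the
square of a variable. -/
lemma pow_mem_span_sq {b : evenInvariants E n} (hb : b ∈ maximalIdeal (evenInvariants E n)) :
    b ^ (n + 1) ∈ Ideal.span (Set.range fun i => XX E i i) := by
  have h := (mem_span_smul_top_iff (M := evenInvariants E n)
    (θ := (evenInvariants E n).val.toAddMonoidHom) (T := parityExponents 0) (d := 2)
    (x := fun i => XX E i i) Subtype.val_injective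
    (fun f hf => ⟨⟨f, (mem_evenInvariants_iff E n).mpr hf⟩, rfl⟩)
    (fun v => (mem_evenInvariants_iff E n).mp v.2)
    (fun _ _ h => add_single_two_mem_parityExponents_iff.mp h)
    (fun i v => by rw [← coe_XX_self]; rfl) Finset.univ (b ^ (n + 1))).mpr fun m hm => ?_
  · simpa using h
  · have h1 : m.degree < n + 1 := by
      rw [degree_eq_sum, Nat.lt_succ_iff]
      calc ∑ i, m i ≤ ∑ i : Fin n, 1 := Finset.sum_le_sum fun i _ =>
            Nat.lt_succ_iff.mp (hm i (Finset.mem_univ i))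
        _ = n := by simp
    refine coeff_of_lt_order (lt_of_lt_of_le ?_ (le_order_pow_of_constantCoeff_eq_zero (n + 1)
      (f := (b : MvPowerSeries (Fin n) E)) (mem_maximalIdeal_iff.mp hb)))
    exact_mod_cast h1

end evenInvariants

end Generators

/-! ### Freeness over the power series in the squares. -/

section Expand

open MvPowerSeries Finsupp

namespace MvPowerSeries

variable {σ E : Type*} [CommRing E]

/-- The power series whose coefficient at `m` is the coefficient of `f` at `2 • m + s`. -/
noncomputable def strided (s : σ →₀ ℕ) : MvPowerSeries σ E →ₗ[E] MvPowerSeries σ E where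
  toFun f := fun m => coeff (2 • m + s) f
  map_add' _ _ := rfl
  map_smul' _ _ := rfl

lemma coeff_strided (s m : σ →₀ ℕ) (f : MvPowerSeries σ E) :
    coeff m (strided s f) = coeff (2 • m + s) f := rfl

/-- Only even exponents occur in the expanded factor, so a contributing splitting of `2m + s` is `2u
+ (2v + s)`; with `s` squarefree, `v` is a genuine exponent. -/
lemma strided_expand_mul [Finite σ] {s : σ →₀ ℕ} (hs : ∀ i, s i ≤ 1) (a f : MvPowerSeries σ E) :
    strided s (expand 2 two_ne_zero a * f) = a * strided s f := by
  classical
  ext m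
  rw [coeff_strided, coeff_mul, coeff_mul]
  symm
  refine Finset.sum_of_injOn (fun p => (2 • p.1, 2 • p.2 + s)) ?_ ?_ ?_ ?_
  · rintro ⟨a, b⟩ - ⟨c, d⟩ - h
    simp only [Prod.mk.injEq, add_left_inj] at h
    have h2 : Function.Injective fun m : σ →₀ ℕ => 2 • m := fun u v huv => by
      ext i
      have := DFunLike.congr_fun huv i
      simp only [Finsupp.smul_apply, smul_eq_mul] at this
      lia
    exact Prod.ext (h2 h.1) (h2 h.2)
  · rintro ⟨a, b⟩ h
    simp only [Finset.mem_coe, Finset.HasAntidiagonal.mem_antidiagonal] at h ⊢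
    rw [← h, smul_add, add_assoc]
  · rintro ⟨u, v⟩ huv hne
    rw [Finset.HasAntidiagonal.mem_antidiagonal] at huv
    dsimp only at huv ⊢
    by_cases hu : ∀ i, 2 ∣ u i
    · refine (hne ⟨(u.mapRange (· / 2) rfl, v.mapRange (· / 2) rfl), ?_, ?_⟩).elim
      · simp only [Finset.mem_coe, Finset.HasAntidiagonal.mem_antidiagonal]
        ext i
        have h1 := DFunLike.congr_fun huv i
        have h2 := hs i
        have h3 := hu i
        simp only [Finsupp.add_apply, Finsupp.smul_apply, smul_eq_mul, mapRange_apply] at h1 ⊢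
        lia
      · refine Prod.ext ?_ ?_ <;> ext i
        all_goals
          have h1 := DFunLike.congr_fun huv i
          have h2 := hs i
          have h3 := hu i
          simp only [Finsupp.add_apply, Finsupp.smul_apply, smul_eq_mul, mapRange_apply] at h1 ⊢
          lia
    · push Not at hu
      obtain ⟨i, hi⟩ := hu
      rw [coeff_expand_of_not_dvd _ _ _ hi, zero_mul]
  · rintro ⟨a, b⟩ -
    rw [coeff_expand_smul, coeff_strided]

lemma strided_monomial_mul {s t : σ →₀ ℕ} (h : t ≤ s) (f : MvPowerSeries σ E) :
    strided s (monomial t 1 * f) = strided (s - t) f := by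
  ext m
  rw [coeff_strided, coeff_strided, coeff_monomial_mul, if_pos (h.trans le_add_self), one_mul,
    add_tsub_assoc_of_le h]

end MvPowerSeries

variable {E : Type u} [Field E] {n : ℕ}

/-- The squarefree exponents of parity `p`. -/
abbrev SquarefreeExponents (n : ℕ) (p : ZMod 2) : Type :=
  {s : Fin n →₀ ℕ // (∀ i, s i ≤ 1) ∧ s ∈ parityExponents p}

variable (n) in
/-- The exponent of the product of all variables. -/
noncomputable def onesExponent : Fin n →₀ ℕ := equivFunOnFinite.symm 1

lemma onesExponent_apply (i : Fin n) : onesExponent n i = 1 := rfl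

instance (p : ZMod 2) : Finite (SquarefreeExponents n p) :=
  Set.Finite.subset (Set.finite_Iic (onesExponent n)) fun _ hs => hs.1

lemma two_smul_half_add_mod (m : Fin n →₀ ℕ) :
    2 • m.mapRange (· / 2) rfl + m.mapRange (· % 2) rfl = m := by
  ext i
  simp only [Finsupp.add_apply, Finsupp.smul_apply, smul_eq_mul, mapRange_apply]
  lia

lemma two_smul_add_mem_parityExponents_iff {p : ZMod 2} {m s : Fin n →₀ ℕ} :
    2 • m + s ∈ parityExponents p ↔ s ∈ parityExponents p := by
  have : ((2 : ℕ) : ZMod 2) = 0 := rfl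
  simp only [parityExponents, Set.mem_ofPred_eq, map_add, map_nsmul, Nat.cast_add, smul_eq_mul,
    Nat.cast_mul, this, zero_mul, zero_add]

lemma half_two_smul_add {m s : Fin n →₀ ℕ} (hs : ∀ i, s i ≤ 1) :
    (2 • m + s).mapRange (· / 2) rfl = m := by
  ext i
  have := hs i
  simp only [Finsupp.add_apply, Finsupp.smul_apply, smul_eq_mul, mapRange_apply]
  omega

lemma mod_two_smul_add {m s : Fin n →₀ ℕ} (hs : ∀ i, s i ≤ 1) :
    (2 • m + s).mapRange (· % 2) rfl = s := by
  ext i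
  have := hs i
  simp only [Finsupp.add_apply, Finsupp.smul_apply, smul_eq_mul, mapRange_apply]
  omega

lemma mod_mem {p : ZMod 2} {m : Fin n →₀ ℕ} (hm : m ∈ parityExponents p) :
    (∀ i, m.mapRange (· % 2) rfl i ≤ 1) ∧ m.mapRange (· % 2) rfl ∈ parityExponents p := by
  refine ⟨fun i => ?_, ?_⟩
  · rw [mapRange_apply]
    lia
  · rwa [← two_smul_half_add_mod m, two_smul_add_mem_parityExponents_iff] at hm

open Classical in
/-- The power series of parity `p` whose subseries along the squarefree exponents are given. -/
noncomputable def assemble {p : ZMod 2} (h : SquarefreeExponents n p → MvPowerSeries (Fin n) E) :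
    MvPowerSeries (Fin n) E := fun m =>
  if hm : m ∈ parityExponents p then
    coeff (m.mapRange (· / 2) rfl) (h ⟨m.mapRange (· % 2) rfl, mod_mem hm⟩) else 0

lemma strided_assemble {p : ZMod 2} (h : SquarefreeExponents n p → MvPowerSeries (Fin n) E)
    (s : SquarefreeExponents n p) : strided (s : Fin n →₀ ℕ) (assemble h) = h s := by
  ext m
  rw [coeff_strided, coeff_apply, assemble,
    dif_pos (two_smul_add_mem_parityExponents_iff.mpr s.2.2)]
  simp only [half_two_smul_add s.2.1, mod_two_smul_add s.2.1]

variable [CharZero E]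

lemma assemble_mem {p : ZMod 2} (h : SquarefreeExponents n p → MvPowerSeries (Fin n) E) :
    assemble h ∈ parityPart E n p := by
  intro m hm
  by_contra hne
  exact hm (by rw [coeff_apply, assemble, dif_neg hne])

lemma parityPart_ext {p : ZMod 2} {f g : MvPowerSeries (Fin n) E} (hf : f ∈ parityPart E n p)
    (hg : g ∈ parityPart E n p)
    (h : ∀ s : SquarefreeExponents n p, strided (s : Fin n →₀ ℕ) f = strided (s : Fin n →₀ ℕ) g) :
    f = g := by
  ext m
  by_cases hm : m ∈ parityExponents p
  · have := congrArg (coeff (m.mapRange (· / 2) rfl)) (h ⟨m.mapRange (· % 2) rfl, mod_mem hm⟩)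
    simpa only [coeff_strided, two_smul_half_add_mod] using this
  · rw [not_not.mp fun h' => hm (hf m h'), not_not.mp fun h' => hm (hg m h')]

lemma assemble_strided {p : ZMod 2} {f : MvPowerSeries (Fin n) E} (hf : f ∈ parityPart E n p) :
    assemble (fun s : SquarefreeExponents n p => strided (s : Fin n →₀ ℕ) f) = f :=
  parityPart_ext (assemble_mem _) hf fun s => strided_assemble _ s

namespace evenInvariants

variable (E n) in
/-- The embedding of the ring of power series into the ring of invariants which sends each
variable to its square. -/
noncomputable def expandHom : MvPowerSeries (Fin n) E →+* evenInvariants E n :=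
  ((expand 2 two_ne_zero).codRestrict (evenInvariants E n) fun f =>
    (mem_evenInvariants_iff E n).mpr fun m hm => by
      have h : ∀ i, 2 ∣ m i := fun i => by
        by_contra hi
        exact hm (coeff_expand_of_not_dvd _ _ _ hi)
      have h0 : (0 : Fin n →₀ ℕ) ∈ parityExponents 0 := by simp [parityExponents]
      rw [← two_smul_add_mem_parityExponents_iff (m := m.mapRange (· / 2) rfl)] at h0
      convert h0
      ext i
      have := h i
      simp only [Finsupp.add_apply, Finsupp.smul_apply, smul_eq_mul, mapRange_apply,
        Finsupp.zero_apply]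
      lia : MvPowerSeries (Fin n) E →ₐ[E] evenInvariants E n)

lemma coe_expandHom (f : MvPowerSeries (Fin n) E) :
    (expandHom E n f : MvPowerSeries (Fin n) E) = expand 2 two_ne_zero f := rfl

variable (E n) in
/-- An even power series is determined by its subseries along the even squarefree exponents. -/
noncomputable def stridedEquiv :
    evenInvariants E n ≃+ (SquarefreeExponents n 0 → MvPowerSeries (Fin n) E) where
  toFun b s := strided (s : Fin n →₀ ℕ) (b : MvPowerSeries (Fin n) E)
  map_add' _ _ := rfl
  invFun h := ⟨assemble h, mem_evenInvariants_iff_mem_parityPart.mpr (assemble_mem h)⟩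
  left_inv b := Subtype.ext (assemble_strided (mem_evenInvariants_iff_mem_parityPart.mp b.2))
  right_inv h := funext fun s => strided_assemble h s

variable (E n) in
/-- The ring of invariants is free over the power series ring in the squares of the variables. -/
noncomputable def linearEquivPi :
    (ModuleCat.restrictScalars (expandHom E n)).obj (ModuleCat.of _ (evenInvariants E n))
      ≃ₗ[MvPowerSeries (Fin n) E] (SquarefreeExponents n 0 → MvPowerSeries (Fin n) E) :=
  { stridedEquiv E n with
    map_smul' := fun a (b : evenInvariants E n) =>
      funext fun s => strided_expand_mul s.2.1 a (b : MvPowerSeries (Fin n) E) }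

variable (E) in
/-- A squarefree monomial, as an element of the ring of invariants. -/
noncomputable def squarefreeMonomial (s : SquarefreeExponents n 0) : evenInvariants E n :=
  ⟨monomial (s : Fin n →₀ ℕ) 1,
    mem_evenInvariants_iff_mem_parityPart.mpr (monomial_mem_parityPart s.2.2 1)⟩

/-- Uniqueness of the decomposition `2m + t`: the basis behind `linearEquivPi` is that of the
squarefree monomials. -/
lemma linearEquivPi_squarefreeMonomial [DecidableEq (SquarefreeExponents n 0)]
    (s : SquarefreeExponents n 0) :
    linearEquivPi E n (squarefreeMonomial E s) = Pi.single s 1 := by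
  ext t m
  change coeff m (strided (t : Fin n →₀ ℕ) (monomial (s : Fin n →₀ ℕ) (1 : E))) = _
  classical
  rw [coeff_strided, coeff_monomial, Pi.single_apply]
  by_cases h : 2 • m + (t : Fin n →₀ ℕ) = s
  · rw [if_pos h]
    have h1 := mod_two_smul_add (m := m) t.2.1
    have h2 := half_two_smul_add (m := m) t.2.1
    have h3 := mod_two_smul_add (m := 0) s.2.1
    have h4 := half_two_smul_add (m := 0) s.2.1
    rw [smul_zero, zero_add] at h3 h4
    rw [h] at h1 h2
    rw [if_pos (Subtype.ext (h1.symm.trans h3)), ← h2, h4, coeff_zero_one]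
  · rw [if_neg h]
    split_ifs with h'
    · rw [coeff_one, if_neg]
      rintro rfl
      exact h (by rw [h', smul_zero, zero_add])
    · rfl

instance : Module.Free (MvPowerSeries (Fin n) E)
    ((ModuleCat.restrictScalars (expandHom E n)).obj (ModuleCat.of _ (evenInvariants E n))) :=
  .of_equiv (linearEquivPi E n).symm

instance : IsNoetherianRing (evenInvariants E n) := by
  algebraize [expandHom E n]
  have : Module.Finite (MvPowerSeries (Fin n) E) (evenInvariants E n) :=
    Module.Finite.equiv (M := SquarefreeExponents n 0 → MvPowerSeries (Fin n) E)
      (linearEquivPi E n).symm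
  exact IsNoetherianRing.of_finite (MvPowerSeries (Fin n) E) _

end evenInvariants

end Expand

/-! ### The trace pairing and finite injective dimension. -/

section Duality

open MvPowerSeries Finsupp

variable {E : Type u} [Field E] [CharZero E] {n : ℕ}

namespace evenInvariants

/-- Complementation of squarefree exponents, the combinatorial form of the duality. -/
lemma one_sub_mem {s : Fin n →₀ ℕ} {p q : ZMod 2} (hs : (∀ i, s i ≤ 1) ∧ s ∈ parityExponents p)
    (hpq : p + q = n) :
    (∀ i, (onesExponent n - s) i ≤ 1) ∧ onesExponent n - s ∈ parityExponents q := by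
  refine ⟨fun i => tsub_le_self, ?_⟩
  have h1 : onesExponent n - s + s = onesExponent n := tsub_add_cancel_of_le fun i => hs.1 i
  have h2 := congrArg degree h1
  rw [map_add, degree_eq_sum (onesExponent n)] at h2
  simp only [onesExponent_apply, Finset.sum_const, Finset.card_univ, Fintype.card_fin,
    smul_eq_mul, mul_one] at h2
  have h3 := congrArg (Nat.cast (R := ZMod 2)) h2
  have h4 := hs.2
  rw [parityExponents, Set.mem_ofPred_eq] at h4 ⊢
  rw [Nat.cast_add, h4, ← hpq, add_comm] at h3
  exact add_left_cancel h3

lemma one_sub_one_sub {s : Fin n →₀ ℕ} (hs : ∀ i, s i ≤ 1) :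
    onesExponent n - (onesExponent n - s) = s := by
  ext i
  have := hs i
  simp only [Finsupp.tsub_apply, onesExponent_apply]
  omega

variable (E n) in
/-- The trace form on the power series of the same parity as the number of variables. -/
noncomputable def trace :
    (ModuleCat.restrictScalars (expandHom E n)).obj (ModuleCat.of (evenInvariants E n) (parityPart E n (n : ZMod 2)))
      →ₗ[MvPowerSeries (Fin n) E] MvPowerSeries (Fin n) E where
  toFun := fun (w : parityPart E n (n : ZMod 2)) =>
    strided (onesExponent n) (w : MvPowerSeries (Fin n) E)
  map_add' _ _ := rfl
  map_smul' := fun a (w : parityPart E n (n : ZMod 2)) =>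
    strided_expand_mul (fun _ => le_rfl) a (w : MvPowerSeries (Fin n) E)

variable (E n) in
/-- The pairing induced by the trace form, as a map to the coextension of scalars. -/
noncomputable def toCoextendScalars :
    ModuleCat.of (evenInvariants E n) (parityPart E n (n : ZMod 2)) ⟶
      (ModuleCat.coextendScalars (expandHom E n)).obj
        (ModuleCat.of (MvPowerSeries (Fin n) E) (MvPowerSeries (Fin n) E)) :=
  ModuleCat.RestrictionCoextensionAdj.HomEquiv.fromRestriction (expandHom E n)
    (ModuleCat.ofHom (X := (ModuleCat.restrictScalars (expandHom E n)).obj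
      (ModuleCat.of (evenInvariants E n) (parityPart E n (n : ZMod 2)))) (trace E n))

lemma toCoextendScalars_apply (w : parityPart E n (n : ZMod 2)) (b : evenInvariants E n) :
    ((toCoextendScalars E n).hom w b : MvPowerSeries (Fin n) E) =
      strided (onesExponent n) (b * w : MvPowerSeries (Fin n) E) := rfl

lemma toCoextendScalars_squarefreeMonomial (w : parityPart E n (n : ZMod 2))
    (s : SquarefreeExponents n 0) :
    ((toCoextendScalars E n).hom w (squarefreeMonomial E s) : MvPowerSeries (Fin n) E) =
      strided (onesExponent n - (s : Fin n →₀ ℕ)) (w : MvPowerSeries (Fin n) E) := by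
  rw [toCoextendScalars_apply]
  exact strided_monomial_mul (fun i => s.2.1 i) _

/-- Pairing `w` with the monomial of `s` reads off the piece of `w` along the complement of `s`.
Complementation matches even squarefree exponents with those of the parity of `n`, so the pairing is
perfect. -/
theorem toCoextendScalars_bijective : Function.Bijective (toCoextendScalars E n).hom := by
  classical
  constructor
  · refine (injective_iff_map_eq_zero _).mpr fun w hw => Subtype.ext ?_
    refine parityPart_ext w.2 (Submodule.zero_mem _) fun s => ?_
    have := toCoextendScalars_squarefreeMonomial w
      ⟨onesExponent n - s, one_sub_mem s.2 (add_zero _)⟩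
    rw [hw, one_sub_one_sub s.2.1] at this
    rw [← this, map_zero]
    rfl
  · intro h
    -- The piece of the preimage along `s` is forced to be the value of `h` on the complementary
    -- monomial.
    let g : SquarefreeExponents n (n : ZMod 2) → MvPowerSeries (Fin n) E := fun s =>
      h (squarefreeMonomial E ⟨onesExponent n - s, one_sub_mem s.2 (add_zero _)⟩)
    let w : MvPowerSeries (Fin n) E := assemble g
    refine ⟨⟨w, assemble_mem _⟩, ?_⟩
    apply ModuleCat.CoextendScalars.ext
    refine (Module.Basis.ofEquivFun (linearEquivPi E n)).ext fun s => ?_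
    have hs : Module.Basis.ofEquivFun (linearEquivPi E n) s = squarefreeMonomial E s := by
      rw [Module.Basis.coe_ofEquivFun]
      exact (LinearEquiv.symm_apply_eq _).mpr (linearEquivPi_squarefreeMonomial s).symm
    have key : ((toCoextendScalars E n).hom ⟨w, assemble_mem _⟩ (squarefreeMonomial E s) :
        MvPowerSeries (Fin n) E) = h (squarefreeMonomial E s) := by
      refine (toCoextendScalars_squarefreeMonomial ⟨w, assemble_mem _⟩ s).trans ?_
      refine (strided_assemble g ⟨onesExponent n - (s : Fin n →₀ ℕ),
        one_sub_mem s.2 (zero_add _)⟩).trans ?_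
      simp only [g, one_sub_one_sub s.2.1]
    exact (congrArg _ hs).trans (key.trans (congrArg _ hs.symm))

/-- By the trace pairing this module is coextended from the regular power series ring. -/
theorem hasInjectiveDimensionLE_parityPart :
    HasInjectiveDimensionLE (ModuleCat.of (evenInvariants E n) (parityPart E n (n : ZMod 2))) n := by
  have := MvPowerSeries.hasInjectiveDimensionLE
    (ModuleCat.of (MvPowerSeries (Fin n) E) (MvPowerSeries (Fin n) E))
  have := ModuleCat.hasInjectiveDimensionLE_coextendScalars (expandHom E n)
    (Module.Projective.of_free) (ModuleCat.of (MvPowerSeries (Fin n) E) (MvPowerSeries (Fin n) E)) n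
  exact hasInjectiveDimensionLT_of_iso
    (LinearEquiv.ofBijective _ toCoextendScalars_bijective).toModuleIso.symm _

theorem hasInjectiveDimensionLE_of_even (hn : Even n) :
    HasInjectiveDimensionLE (ModuleCat.of (evenInvariants E n) (evenInvariants E n)) n := by
  have h := hasInjectiveDimensionLE_parityPart (E := E) (n := n)
  rw [ZMod.natCast_eq_zero_iff_even.mpr hn] at h
  let e : parityPart E n 0 ≃ₗ[evenInvariants E n] evenInvariants E n :=
    { toFun w := ⟨w, mem_evenInvariants_iff_mem_parityPart.mpr w.2⟩
      map_add' _ _ := rfl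
      map_smul' _ _ := rfl
      invFun b := ⟨b, mem_evenInvariants_iff_mem_parityPart.mp b.2⟩
      left_inv _ := rfl
      right_inv _ := rfl }
  have i : ModuleCat.of (evenInvariants E n) (parityPart E n 0) ≅
      ModuleCat.of (evenInvariants E n) (evenInvariants E n) :=
    LinearEquiv.toModuleIso (X₁ := parityPart E n 0) (X₂ := evenInvariants E n) e
  exact hasInjectiveDimensionLT_of_iso i _

end evenInvariants

end Duality

/-! ### Socles and Ext of the residue field. -/

section LocalAlgebra

variable {R : Type u} [CommRing R] [IsLocalRing R]

theorem IsLocalRing.krullDimLE_zero_quotient {I : Ideal R} (h : maximalIdeal R ≤ I.radical) :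
    Ring.KrullDimLE 0 (R ⧸ I) := by
  rw [Ring.krullDimLE_zero_iff]
  intro Q hQ
  have h1 : I ≤ Q.comap (Ideal.Quotient.mk I) := fun a ha => by
    rw [Ideal.mem_comap, Ideal.Quotient.eq_zero_iff_mem.mpr ha]
    exact Q.zero_mem
  have h2 : maximalIdeal R ≤ Q.comap (Ideal.Quotient.mk I) :=
    h.trans ((hQ.comap _).radical_le_iff.mpr h1)
  have h3 : (Q.comap (Ideal.Quotient.mk I)).IsMaximal :=
    (maximalIdeal.isMaximal R).eq_of_le (hQ.comap _).ne_top h2 ▸ maximalIdeal.isMaximal R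
  have h4 := Ideal.map_eq_top_or_isMaximal_of_surjective (Ideal.Quotient.mk I)
    Ideal.Quotient.mk_surjective h3
  rw [Ideal.map_comap_of_surjective _ Ideal.Quotient.mk_surjective] at h4
  exact h4.resolve_left hQ.ne_top

theorem IsLocalRing.isFiniteLength_quotient [IsNoetherianRing R] {I : Ideal R}
    (h : maximalIdeal R ≤ I.radical) : IsFiniteLength R (R ⧸ (I • ⊤ : Submodule R R)) := by
  have : IsArtinianRing (R ⧸ I) :=
    isArtinianRing_iff_krullDimLE_zero.mpr (krullDimLE_zero_quotient h)
  refine IsFiniteLength.of_isArtinianRing_quotient I _ fun x r => ?_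
  obtain ⟨x, rfl⟩ := Submodule.Quotient.mk_surjective _ x
  rw [← Submodule.Quotient.mk_smul, Submodule.Quotient.mk_eq_zero]
  exact Submodule.smul_mem_smul r.2 trivial

open RingTheory.Sequence in
/-- The socle of an Artinian quotient of a Gorenstein ring by a regular sequence is
one-dimensional. -/
theorem IsLocalRing.not_isGorensteinLocalRing [IsNoetherianRing R] {rs : List R}
    (reg : IsRegular R rs) (h : maximalIdeal R ≤ (Ideal.ofList rs).radical) {s t : R}
    (hs : ∀ a ∈ maximalIdeal R, a * s ∈ Ideal.ofList rs)
    (ht : ∀ a ∈ maximalIdeal R, a * t ∈ Ideal.ofList rs) (hs0 : s ∉ Ideal.ofList rs)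
    (hst : ∀ b, t - b * s ∉ Ideal.ofList rs) : ¬ IsGorensteinLocalRing R := fun hG => by
  obtain ⟨m, hm⟩ := hG.exists_hasInjectiveDimensionLE
  obtain ⟨b, hb⟩ := exists_sub_mul_mem_of_hasInjectiveDimensionLE reg (isFiniteLength_quotient h)
    hm hs ht hs0
  exact hst b hb

/-- If the socle of `Q` is one-dimensional, then `Hom(k, Q) ≃ k`. -/
theorem IsLocalRing.nonempty_linearEquiv_residueField {Q : Type*} [AddCommGroup Q] [Module R Q]
    {u : Q} (hu0 : u ≠ 0) (hu : ∀ a ∈ maximalIdeal R, a • u = 0)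
    (h : ∀ v : Q, (∀ a ∈ maximalIdeal R, a • v = 0) → ∃ r : R, v = r • u) :
    Nonempty ((ResidueField R →ₗ[R] Q) ≃ₗ[R] ResidueField R) := by
  let g₀ : (R ⧸ maximalIdeal R) →ₗ[R] Q :=
    (maximalIdeal R).liftQ (LinearMap.toSpanSingleton R Q u) fun a ha => hu a ha
  let φ : R →ₗ[R] ((R ⧸ maximalIdeal R) →ₗ[R] Q) := LinearMap.toSpanSingleton R _ g₀
  have hφ1 (r : R) : φ r (Submodule.Quotient.mk 1) = r • u := by
    change r • (1 : R) • u = r • u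
    rw [one_smul]
  have hφ : Function.Surjective φ := fun f => by
    obtain ⟨r, hr⟩ := h (f (Submodule.Quotient.mk 1)) fun a ha => by
      rw [← map_smul, ← Submodule.Quotient.mk_smul, smul_eq_mul, mul_one,
        (Submodule.Quotient.mk_eq_zero _).mpr ha, map_zero]
    refine ⟨r, ?_⟩
    apply Submodule.linearMap_qext
    ext
    exact (hφ1 r).trans hr.symm
  have hker : LinearMap.ker φ = maximalIdeal R := by
    ext r
    rw [LinearMap.mem_ker]
    constructor
    · intro hr
      by_contra hr'
      rw [IsLocalRing.notMem_maximalIdeal] at hr'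
      have := hφ1 r
      rw [hr, LinearMap.zero_apply, eq_comm, hr'.smul_eq_zero] at this
      exact hu0 this
    · intro hr
      apply Submodule.linearMap_qext
      ext
      exact (hφ1 r).trans (hu r hr)
  exact ⟨((Submodule.quotEquivOfEq _ _ hker.symm).trans
    (φ.quotKerEquivOfSurjective hφ)).symm⟩

open RingTheory.Sequence in
/-- If the socle of `M / rs M` is one-dimensional, then so is `Ext(k, M)` in degree `rs.length`. -/
theorem ModuleCat.nonempty_ext_linearEquiv_residueField {rs : List R} {M : Type u}
    [AddCommGroup M] [Module R M] (reg : IsWeaklyRegular M rs) (mem : ∀ r ∈ rs, r ∈ maximalIdeal R)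
    {u : M} (hu0 : u ∉ (Ideal.ofList rs • ⊤ : Submodule R M))
    (hu : ∀ a ∈ maximalIdeal R, a • u ∈ (Ideal.ofList rs • ⊤ : Submodule R M))
    (h : ∀ v : M, (∀ a ∈ maximalIdeal R, a • v ∈ (Ideal.ofList rs • ⊤ : Submodule R M)) →
      ∃ r : R, v - r • u ∈ (Ideal.ofList rs • ⊤ : Submodule R M)) :
    Nonempty (Abelian.Ext (ModuleCat.of R (ResidueField R)) (ModuleCat.of R M) rs.length
      ≃ₗ[R] ResidueField R) := by
  obtain ⟨e⟩ := IsLocalRing.nonempty_linearEquiv_residueField (R := R)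
    (Q := M ⧸ (Ideal.ofList rs • ⊤ : Submodule R M)) (u := Submodule.Quotient.mk u)
    (by rwa [Ne, Submodule.Quotient.mk_eq_zero])
    (fun a ha => by
      rw [← Submodule.Quotient.mk_smul, Submodule.Quotient.mk_eq_zero]
      exact hu a ha)
    (fun v hv => by
      obtain ⟨v, rfl⟩ := Submodule.Quotient.mk_surjective _ v
      obtain ⟨r, hr⟩ := h v fun a ha => by
        have := hv a ha
        rwa [← Submodule.Quotient.mk_smul, Submodule.Quotient.mk_eq_zero] at this
      refine ⟨r, ?_⟩
      rwa [← Submodule.Quotient.mk_smul, ← sub_eq_zero, ← Submodule.Quotient.mk_sub,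
        Submodule.Quotient.mk_eq_zero])
  obtain ⟨e'⟩ := ModuleCat.nonempty_linearEquiv_ext (M := ModuleCat.of R M) reg
    (N := ModuleCat.of R (ResidueField R)) fun r hr x => by
      obtain ⟨y, rfl⟩ := IsLocalRing.residue_surjective (x : ResidueField R)
      change residue _ r * residue _ y = 0
      rw [(residue_eq_zero_iff r).mpr (mem r hr), zero_mul]
  exact ⟨e'.symm.trans e⟩

end LocalAlgebra

/-! ### The squares of the variables as a regular sequence of parameters. -/

section RegularSequence

open MvPowerSeries Finsupp RingTheory.Sequence

variable {E : Type u} [Field E] [CharZero E] {n : ℕ}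

namespace evenInvariants

variable (E n) in
/-- The squares of the variables. -/
noncomputable abbrev squares : List (evenInvariants E n) := List.ofFn fun i => XX E i i

lemma squares_smul_mem_iff {p : ZMod 2} {w : parityPart E n p} :
    w ∈ (Ideal.ofList (squares E n) • ⊤ : Submodule (evenInvariants E n) (parityPart E n p)) ↔
      ∀ m : Fin n →₀ ℕ, (∀ i, m i < 2) → coeff m (w : MvPowerSeries (Fin n) E) = 0 := by
  have := mem_span_smul_top_iff (M := parityPart E n p) 
    (θ := (AddSubgroupClass.subtype (parityPart E n p) : parityPart E n p →+ MvPowerSeries (Fin n) E))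
    (T := parityExponents p) (d := 2) (x := fun i => XX E i i) Subtype.val_injective
    (fun f hf => ⟨⟨f, hf⟩, rfl⟩) (fun v => mem_parityPart_iff.mp v.2)
    (fun _ _ h => add_single_two_mem_parityExponents_iff.mp h)
    (fun i v => by rw [← coe_XX_self]; rfl) Finset.univ w
  rw [Finset.coe_univ, Set.image_univ, ← ofList_ofFn] at this
  simp only [Finset.mem_univ, true_imp_iff] at this
  exact this

lemma isWeaklyRegular_squares_parityPart (p : ZMod 2) :
    IsWeaklyRegular (parityPart E n p) (squares E n) :=
  isWeaklyRegular_ofFn (M := parityPart E n p) 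
    (θ := (AddSubgroupClass.subtype (parityPart E n p) : parityPart E n p →+ MvPowerSeries (Fin n) E))
    (T := parityExponents p) (d := 2) (x := fun i => XX E i i) Subtype.val_injective
    (fun f hf => ⟨⟨f, hf⟩, rfl⟩) (fun v => mem_parityPart_iff.mp v.2)
    (fun _ _ h => add_single_two_mem_parityExponents_iff.mp h)
    (fun i v => by rw [← coe_XX_self]; rfl)

lemma mem_ofList_squares_iff {b : evenInvariants E n} :
    b ∈ Ideal.ofList (squares E n) ↔
      ∀ m : Fin n →₀ ℕ, (∀ i, m i < 2) → coeff m (b : MvPowerSeries (Fin n) E) = 0 := by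
  have := mem_span_smul_top_iff (M := evenInvariants E n)
    (θ := (evenInvariants E n).val.toAddMonoidHom) (T := parityExponents 0) (d := 2)
    (x := fun i => XX E i i) Subtype.val_injective
    (fun f hf => ⟨⟨f, (mem_evenInvariants_iff E n).mpr hf⟩, rfl⟩)
    (fun v => (mem_evenInvariants_iff E n).mp v.2)
    (fun _ _ h => add_single_two_mem_parityExponents_iff.mp h)
    (fun i v => by rw [← coe_XX_self]; rfl) Finset.univ b
  rw [Finset.coe_univ, Set.image_univ, ← ofList_ofFn] at this
  simpa using this

lemma mem_maximalIdeal_of_mem_squares {r : evenInvariants E n} (hr : r ∈ squares E n) :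
    r ∈ maximalIdeal (evenInvariants E n) := by
  obtain ⟨i, rfl⟩ := List.mem_ofFn.mp hr
  exact quadric_mem_maximalIdeal s(i, i)

lemma isRegular_squares : IsRegular (evenInvariants E n) (squares E n) :=
  .of_isWeaklyRegular_of_mem_maximalIdeal _ (fun _ hr => mem_maximalIdeal_of_mem_squares hr)
    (isWeaklyRegular_ofFn (M := evenInvariants E n)
    (θ := (evenInvariants E n).val.toAddMonoidHom) (T := parityExponents 0) (d := 2)
    (x := fun i => XX E i i) Subtype.val_injective
    (fun f hf => ⟨⟨f, (mem_evenInvariants_iff E n).mpr hf⟩, rfl⟩)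
    (fun v => (mem_evenInvariants_iff E n).mp v.2)
    (fun _ _ h => add_single_two_mem_parityExponents_iff.mp h)
    (fun i v => by rw [← coe_XX_self]; rfl))

lemma maximalIdeal_le_radical_squares :
    maximalIdeal (evenInvariants E n) ≤ (Ideal.ofList (squares E n)).radical := fun b hb =>
  ⟨n + 1, by
    rw [squares, ofList_ofFn]
    exact pow_mem_span_sq hb⟩

instance : Ring.KrullDimLE 0 (evenInvariants E n ⧸ Ideal.ofList (squares E n)) :=
  IsLocalRing.krullDimLE_zero_quotient maximalIdeal_le_radical_squares

lemma ofList_squares_ne_top : Ideal.ofList (squares E n) ≠ ⊤ := by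
  simpa using (isRegular_squares (E := E) (n := n)).top_ne_smul.symm

-- The squares are a regular sequence of length `n` with zero-dimensional quotient.
variable (E n) in
theorem ringKrullDim_eq : ringKrullDim (evenInvariants E n) = n := by
  have h := ringKrullDim_add_length_eq_ringKrullDim_of_isRegular _
    (isRegular_squares (E := E) (n := n))
  have : Nontrivial (evenInvariants E n ⧸ Ideal.ofList (squares E n)) :=
    Ideal.Quotient.nontrivial_iff.mpr ofList_squares_ne_top
  rw [ringKrullDimZero_iff_ringKrullDim_eq_zero.mp inferInstance, zero_add,
    List.length_ofFn] at h
  exact h.symm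

lemma isMaximalCohenMacaulay : IsMaximalCohenMacaulay (evenInvariants E n) (evenInvariants E n) :=
  ⟨inferInstance, squares E n, fun _ hr => mem_maximalIdeal_of_mem_squares hr, isRegular_squares,
    by rw [ringKrullDim_eq, List.length_ofFn]⟩

instance : IsCohenMacaulayLocalRing (evenInvariants E n) := ⟨isMaximalCohenMacaulay⟩

/-- Every odd monomial is divisible by a variable, with even cofactor, so the variables generate. -/
instance : Module.Finite (evenInvariants E n) (parityPart E n 1) := by
  let x : Fin n → parityPart E n 1 := fun i => ⟨X i, X_mem_parityPart i⟩
  refine .of_surjective (Fintype.linearCombination (evenInvariants E n) x) fun w => ?_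
  obtain ⟨g, hg, hg'⟩ := exists_eq_sum_monomial_mul (fun i => single i 1)
    (w : MvPowerSeries (Fin n) E) fun m hm => exists_single_one_le fun h0 => by
      have := w.2 m hm
      simp [parityExponents, h0] at this
  have hgB (i) : g i ∈ evenInvariants E n := (mem_evenInvariants_iff E n).mpr fun m hm => by
    have := w.2 _ (hg' i m hm)
    simpa [parityExponents] using this
  refine ⟨fun i => ⟨g i, hgB i⟩, Subtype.ext ?_⟩
  rw [Fintype.linearCombination_apply, hg, AddSubmonoidClass.coe_finsetSum]
  exact Finset.sum_congr rfl fun i _ => mul_comm _ _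

lemma isRegular_squares_parityPart_one (hn : 0 < n) :
    IsRegular (parityPart E n 1) (squares E n) :=
  have : Nontrivial (parityPart E n 1) := ⟨⟨X ⟨0, hn⟩, X_mem_parityPart _⟩, 0, fun h => by
    have := congrArg (fun w : parityPart E n 1 => coeff (single ⟨0, hn⟩ 1)
      (w : MvPowerSeries (Fin n) E)) h
    simp [coeff_index_single_self_X] at this⟩
  .of_isWeaklyRegular_of_mem_maximalIdeal _ (fun _ hr => mem_maximalIdeal_of_mem_squares hr)
    (isWeaklyRegular_squares_parityPart 1)

end evenInvariants

end RegularSequence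

/-! ### The canonical module, and the `2`-Gorenstein property for odd `n`. -/

section Canonical

open MvPowerSeries Finsupp RingTheory.Sequence

variable {E : Type u} [Field E] [CharZero E] {n : ℕ}

lemma degree_onesExponent : (onesExponent n).degree = n := by
  simp [degree_eq_sum, onesExponent_apply]

lemma onesExponent_mem (hn : Odd n) : onesExponent n ∈ parityExponents 1 := by
  rw [parityExponents, Set.mem_ofPred_eq, degree_onesExponent, ZMod.natCast_eq_one_iff_odd]
  exact hn

lemma le_onesExponent_iff {m : Fin n →₀ ℕ} : m ≤ onesExponent n ↔ ∀ i, m i < 2 :=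
  forall_congr' fun _ => Nat.lt_succ_iff.symm

/-- A squarefree exponent of the same parity as the number of variables misses at least two
variables unless it is the exponent of the product of all variables. -/
lemma exists_add_le_onesExponent {p : ZMod 2} {m : Fin n →₀ ℕ} (hm : ∀ i, m i < 2)
    (hmp : m ∈ parityExponents p) (hp : onesExponent n ∈ parityExponents p)
    (hne : m ≠ onesExponent n) :
    ∃ i j, single i 1 + single j 1 + m ≤ onesExponent n := by
  have hle := le_onesExponent_iff.mpr hm
  have h1 := tsub_add_cancel_of_le hle
  have h2 : (onesExponent n - m).degree ≠ 0 := fun h => hne (by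
    rw [← h1, (degree_eq_zero_iff _).mp h, zero_add])
  have h3 : Even (onesExponent n - m).degree := by
    have h4 := congrArg (fun m => ((degree m : ℕ) : ZMod 2)) h1
    simp only [parityExponents, Set.mem_ofPred_eq] at hmp hp
    simp only [map_add, Nat.cast_add, hmp, hp, add_eq_right] at h4
    exact ZMod.natCast_eq_zero_iff_even.mp h4
  obtain ⟨k, hk⟩ := h3
  obtain ⟨i, j, hij⟩ := exists_single_add_single_le (m := onesExponent n - m) (by lia)
  exact ⟨i, j, by rwa [le_tsub_iff_right hle] at hij⟩

namespace evenInvariants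

/-- The socle of the odd part modulo the squares is spanned by `x₁⋯xₙ`: any other odd squarefree
monomial misses two variables, and multiplying by their product keeps it nonzero. -/
theorem nonempty_ext_linearEquiv (hn : Odd n) :
    Nonempty (Abelian.Ext (ModuleCat.of (evenInvariants E n) (ResidueField (evenInvariants E n)))
      (ModuleCat.of (evenInvariants E n) (parityPart E n 1)) (squares E n).length
      ≃ₗ[evenInvariants E n] ResidueField (evenInvariants E n)) := by
  classical
  let u : parityPart E n 1 := ⟨monomial (onesExponent n) 1,
    monomial_mem_parityPart (onesExponent_mem hn) 1⟩
  refine ModuleCat.nonempty_ext_linearEquiv_residueField (isWeaklyRegular_squares_parityPart 1)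
    (fun _ hr => mem_maximalIdeal_of_mem_squares hr) (u := u) (fun h => ?_) (fun a ha => ?_)
    fun w hw => ?_
  · have := squares_smul_mem_iff.mp h (onesExponent n) fun i => one_lt_two
    rw [coeff_monomial_same] at this
    exact one_ne_zero this
  · refine squares_smul_mem_iff.mpr fun m hm => ?_
    change coeff m ((a : MvPowerSeries (Fin n) E) * monomial (onesExponent n) 1) = 0
    rw [coeff_mul_monomial]
    split_ifs with h
    · rw [le_antisymm (le_onesExponent_iff.mpr hm) h, tsub_self, mul_one,
        coeff_zero_eq_constantCoeff]
      exact mem_maximalIdeal_iff.mp ha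
    · rfl
  · refine ⟨algebraMap E _ (coeff (onesExponent n) (w : MvPowerSeries (Fin n) E)),
      squares_smul_mem_iff.mpr fun m hm => ?_⟩
    change coeff m ((w : MvPowerSeries (Fin n) E) -
      C (coeff (onesExponent n) (w : MvPowerSeries (Fin n) E)) * monomial (onesExponent n) 1) = 0
    rw [map_sub, coeff_C_mul, coeff_monomial]
    split_ifs with h
    · rw [h, mul_one, sub_self]
    · rw [mul_zero, sub_zero]
      by_contra hne
      obtain ⟨i, j, hij⟩ := exists_add_le_onesExponent hm (w.2 m hne) (onesExponent_mem hn) h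
      have h3 := squares_smul_mem_iff.mp (hw (quadric E s(i, j)) (quadric_mem_maximalIdeal _)) _
        (le_onesExponent_iff.mp hij)
      change coeff _ ((quadric E s(i, j) : MvPowerSeries (Fin n) E) * _) = 0 at h3
      rw [quadric_mk, coe_XX, coeff_add_monomial_mul, one_mul] at h3
      exact hne h3

theorem isCanonicalModule (hn : Odd n) :
    IsCanonicalModule (evenInvariants E n) (parityPart E n 1) where
  isMaximalCohenMacaulay := ⟨inferInstance, squares E n,
    fun _ hr => mem_maximalIdeal_of_mem_squares hr, isRegular_squares_parityPart_one hn.pos,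
    by rw [ringKrullDim_eq, List.length_ofFn]⟩
  exists_hasInjectiveDimensionLE := ⟨n, by
    have := hasInjectiveDimensionLE_parityPart (E := E) (n := n)
    rwa [ZMod.natCast_eq_one_iff_odd.mpr hn] at this⟩
  type_eq_one d hd := by
    rw [ringKrullDim_eq, Nat.cast_inj] at hd
    have hd' : d = (squares E n).length := by rw [hd, List.length_ofFn]
    subst hd'
    exact nonempty_ext_linearEquiv hn

/-- A monomial of `a` has degree at least two, but only one variable is missing from `s`, so the
product contains a square. -/
lemma mul_monomial_mem_squares {s : Fin n →₀ ℕ} {i : Fin n} (hs : s + single i 1 = onesExponent n)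
    {b : evenInvariants E n} (hb : (b : MvPowerSeries (Fin n) E) = monomial s 1)
    {a : evenInvariants E n} (ha : a ∈ maximalIdeal (evenInvariants E n)) :
    a * b ∈ Ideal.ofList (squares E n) := by
  rw [mem_ofList_squares_iff]
  intro m hm
  rw [MulMemClass.coe_mul, hb, coeff_mul_monomial]
  split_ifs with h
  · rw [mul_one]
    by_contra hne
    have h1 := two_le_degree_of_coeff_ne_zero ha hne
    have h2 : m - s ≤ single i 1 := by
      rw [tsub_le_iff_left, hs]
      exact le_onesExponent_iff.mpr hm
    have h3 := degree_mono h2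
    rw [degree_single] at h3
    lia
  · rfl

/-- For odd `n` the products of all variables but one are even and lie in the socle modulo the
squares. Two different ones are not multiples of each other there. -/
theorem not_isGorensteinLocalRing (hn : Odd n) (hn3 : 3 ≤ n) :
    ¬ IsGorensteinLocalRing (evenInvariants E n) := by
  classical
  have hle (i : Fin n) : single i 1 ≤ onesExponent n := single_le_iff.mpr le_rfl
  have hs (i : Fin n) : onesExponent n - single i 1 + single i 1 = onesExponent n :=
    tsub_add_cancel_of_le (hle i)
  have hmem (i : Fin n) : onesExponent n - single i 1 ∈ parityExponents 0 := by
    have h1 := onesExponent_mem hn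
    rw [← hs i] at h1
    simpa [parityExponents] using h1
  let b : Fin n → evenInvariants E n := fun i => ⟨monomial (onesExponent n - single i 1) 1,
    mem_evenInvariants_iff_mem_parityPart.mpr (monomial_mem_parityPart (hmem i) 1)⟩
  let i₀ : Fin n := ⟨0, by lia⟩
  let i₁ : Fin n := ⟨1, by lia⟩
  have h01 : i₁ ≠ i₀ := by simp [i₀, i₁]
  have hlt (i : Fin n) : ∀ j, (onesExponent n - single i 1 : Fin n →₀ ℕ) j < 2 :=
    le_onesExponent_iff.mp tsub_le_self
  refine IsLocalRing.not_isGorensteinLocalRing isRegular_squares maximalIdeal_le_radical_squares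
    (s := b i₀) (t := b i₁) (fun a ha => mul_monomial_mem_squares (hs i₀) rfl ha)
    (fun a ha => mul_monomial_mem_squares (hs i₁) rfl ha) (fun h => ?_) fun c hc => ?_
  · have := mem_ofList_squares_iff.mp h _ (hlt i₀)
    rw [coeff_monomial_same] at this
    exact one_ne_zero this
  · have h1 := mem_ofList_squares_iff.mp hc _ (hlt i₁)
    change coeff (onesExponent n - single i₁ 1) (monomial (onesExponent n - single i₁ 1) 1 -
      (c : MvPowerSeries (Fin n) E) * monomial (onesExponent n - single i₀ 1) 1) = 0 at h1
    rw [map_sub, coeff_monomial_same, coeff_mul_monomial, if_neg, sub_zero] at h1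
    · exact one_ne_zero h1
    · intro h
      have := h i₁
      simp [onesExponent_apply, h01.symm] at this

/-- The multiplication of odd power series. -/
noncomputable def oddMul :
    parityPart E n 1 →ₗ[evenInvariants E n] parityPart E n 1 →ₗ[evenInvariants E n]
      evenInvariants E n :=
  LinearMap.mk₂ _ (fun f g => ⟨f * g, mem_evenInvariants_iff_mem_parityPart.mpr
      (mul_mem_parityPart f.2 g.2)⟩)
    (fun _ _ _ => Subtype.ext (add_mul _ _ _)) (fun _ _ _ => Subtype.ext (mul_assoc _ _ _))
    (fun _ _ _ => Subtype.ext (mul_add _ _ _)) (fun _ _ _ => Subtype.ext (mul_left_comm _ _ _))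

lemma coe_oddMul (f g : parityPart E n 1) :
    (oddMul f g : MvPowerSeries (Fin n) E) = f * g := rfl

lemma oddMul_smul (f g h : parityPart E n 1) : oddMul f g • h = oddMul h g • f :=
  Subtype.ext (by
    change (f * g : MvPowerSeries (Fin n) E) * h = h * g * f
    ring)

/-- Every bilinear form on the odd power series is a multiple of the multiplication. -/
theorem exists_eq_mul_oddMul (hn : 2 ≤ n)
    (β : parityPart E n 1 →ₗ[evenInvariants E n] parityPart E n 1 →ₗ[evenInvariants E n]
      evenInvariants E n) : ∃ b, ∀ f g, β f g = b * oddMul f g := by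
  let x : Fin n → parityPart E n 1 := fun i => ⟨X i, X_mem_parityPart i⟩
  let i₀ : Fin n := ⟨0, by lia⟩
  let i₁ : Fin n := ⟨1, by lia⟩
  have h01 : i₁ ≠ i₀ := by simp [i₀, i₁]
  have : IsDomain (MvPowerSeries (Fin n) E) := NoZeroDivisors.to_isDomain _
  have hX (i : Fin n) : (X i : MvPowerSeries (Fin n) E) ≠ 0 := fun h => by
    have := coeff_index_single_self_X (R := E) i
    rw [h, coeff_zero] at this
    exact zero_ne_one this
  -- Expand `β((f xᵢ) xᵢ, g) = β((xᵢ xᵢ) f, g)` by linearity over the invariants and cancel one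
  -- `xᵢ`, which itself is not a scalar.
  have key1 (f g : parityPart E n 1) (i) : (X i : MvPowerSeries (Fin n) E) * β f g =
      f * β (x i) g := by
    refine mul_left_cancel₀ (hX i) ?_
    have h := congrArg (fun w => (β w g : MvPowerSeries (Fin n) E)) (oddMul_smul f (x i) (x i))
    simp only [map_smul, LinearMap.smul_apply, smul_eq_mul, MulMemClass.coe_mul, coe_oddMul] at h
    change (f : MvPowerSeries (Fin n) E) * X i * (β (x i) g : MvPowerSeries (Fin n) E) =
      X i * X i * (β f g : MvPowerSeries (Fin n) E) at h
    linear_combination -h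
  have key2 (f g : parityPart E n 1) (i) : (X i : MvPowerSeries (Fin n) E) * β f g =
      g * β f (x i) := by
    refine mul_left_cancel₀ (hX i) ?_
    have h := congrArg (fun w => (β f w : MvPowerSeries (Fin n) E)) (oddMul_smul g (x i) (x i))
    simp only [map_smul, smul_eq_mul, MulMemClass.coe_mul, coe_oddMul] at h
    change (g : MvPowerSeries (Fin n) E) * X i * (β f (x i) : MvPowerSeries (Fin n) E) =
      X i * X i * (β f g : MvPowerSeries (Fin n) E) at h
    linear_combination -h
  have key (f g : parityPart E n 1) (i) : (X i : MvPowerSeries (Fin n) E) ^ 2 * β f g =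
      f * g * β (x i) (x i) := by
    linear_combination (X i : MvPowerSeries (Fin n) E) * key1 f g i +
      (f : MvPowerSeries (Fin n) E) * key2 (x i) g i
  -- A second variable is essential: `x₀² β(x₁, x₁) = x₁² β(x₀, x₀)`, and `x₀²` is prime to `x₁²`.
  -- The factor sought is `b = β(x₀, x₀) / x₀²`.
  have hdvd : (X i₀ : MvPowerSeries (Fin n) E) ^ 2 ∣ β (x i₀) (x i₀) := by
    rw [X_pow_dvd_iff]
    intro m hm
    have h1 := key (x i₁) (x i₁) i₀
    change _ = X i₁ * X i₁ * _ at h1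
    rw [← pow_two] at h1
    have h2 : (X i₀ : MvPowerSeries (Fin n) E) ^ 2 ∣
        X i₁ ^ 2 * (β (x i₀) (x i₀) : MvPowerSeries (Fin n) E) := ⟨_, h1.symm⟩
    rw [X_pow_dvd_iff] at h2
    have h3 := h2 (single i₁ 2 + m) (by
      rwa [Finsupp.add_apply, single_eq_of_ne h01.symm, zero_add])
    rwa [X_pow_eq, coeff_add_monomial_mul, one_mul] at h3
  obtain ⟨b, hb⟩ := hdvd
  have hbB : b ∈ evenInvariants E n := by
    rw [mem_evenInvariants_iff]
    intro m hm
    have h1 := (mem_evenInvariants_iff E n).mp (β (x i₀) (x i₀)).2 (m + single i₀ 2) (by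
      rwa [hb, X_pow_eq, add_comm, coeff_add_monomial_mul, one_mul])
    exact add_single_two_mem_parityExponents_iff.mp h1
  refine ⟨⟨b, hbB⟩, fun f g => Subtype.ext (mul_left_cancel₀ (pow_ne_zero 2 (hX i₀)) ?_)⟩
  rw [key, hb, MulMemClass.coe_mul, coe_oddMul]
  ring

/-- The first dual is already free, generated by multiplication, so the second dual is free too. -/
theorem nonempty_dual_dual_linearEquiv (hn : 2 ≤ n) :
    Nonempty (Module.Dual (evenInvariants E n) (Module.Dual (evenInvariants E n)
      (parityPart E n 1 ⊗[evenInvariants E n] parityPart E n 1)) ≃ₗ[evenInvariants E n]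
        evenInvariants E n) := by
  let μ : Module.Dual (evenInvariants E n)
      (parityPart E n 1 ⊗[evenInvariants E n] parityPart E n 1) := TensorProduct.lift oddMul
  let φ : evenInvariants E n →ₗ[evenInvariants E n] Module.Dual (evenInvariants E n)
      (parityPart E n 1 ⊗[evenInvariants E n] parityPart E n 1) :=
    LinearMap.toSpanSingleton _ _ μ
  have hφ (b : evenInvariants E n) (f g : parityPart E n 1) : φ b (f ⊗ₜ g) = b * oddMul f g := by
    rfl
  have hbij : Function.Bijective φ := by
    constructor
    · refine (injective_iff_map_eq_zero _).mpr fun b hb => ?_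
      let x : parityPart E n 1 := ⟨X ⟨0, by lia⟩, X_mem_parityPart _⟩
      have h := hφ b x x
      rw [hb, LinearMap.zero_apply, eq_comm, mul_eq_zero] at h
      refine h.resolve_right fun h => ?_
      have h2 := congrArg (fun b : evenInvariants E n =>
        coeff (single ⟨0, by lia⟩ 2) (b : MvPowerSeries (Fin n) E)) h
      change coeff _ (X _ * X _) = coeff _ 0 at h2
      rw [← pow_two, X_pow_eq, coeff_monomial_same, coeff_zero] at h2
      exact one_ne_zero h2
    · intro γ
      obtain ⟨b, hb⟩ := exists_eq_mul_oddMul hn (TensorProduct.curry γ)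
      exact ⟨b, TensorProduct.ext' fun f g => (hφ b f g).trans (hb f g).symm⟩
  exact ⟨(LinearEquiv.ofBijective φ hbij).dualMap.trans
    (LinearMap.ringLmapEquivSelf (evenInvariants E n) (evenInvariants E n) (evenInvariants E n))⟩

end evenInvariants

end Canonical

/-! ### Normality through complete integral closedness. -/

section CompleteIntegralClosedness

/-- A ring is completely integrally closed if `b ∣ a` whenever the powers of the fraction `a / b`
have a common denominator. -/
def IsCompletelyIntegrallyClosed (R : Type*) [CommRing R] : Prop :=
  ∀ a b c : R, c ≠ 0 → (∀ k, b ^ k ∣ c * a ^ k) → b ∣ a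

lemma Field.isCompletelyIntegrallyClosed (K : Type*) [Field K] :
    IsCompletelyIntegrallyClosed K := fun a b c hc h => by
  obtain rfl | hb := eq_or_ne b 0
  · have := h 1
    rw [pow_one, pow_one, zero_dvd_iff, mul_eq_zero] at this
    rw [this.resolve_left hc]
  · exact (IsUnit.mk0 b hb).dvd

lemma IsCompletelyIntegrallyClosed.of_ringEquiv {R S : Type*} [CommRing R] [CommRing S]
    (e : R ≃+* S) (h : IsCompletelyIntegrallyClosed R) : IsCompletelyIntegrallyClosed S := by
  intro a b c hc hk
  have := h (e.symm a) (e.symm b) (e.symm c) (by simpa using hc) fun k => by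
    have := map_dvd e.symm (hk k)
    simpa using this
  simpa using map_dvd e this

lemma IsCompletelyIntegrallyClosed.isIntegrallyClosed {R : Type*} [CommRing R] [IsDomain R]
    (h : IsCompletelyIntegrallyClosed R) : IsIntegrallyClosed R := by
  refine (isIntegrallyClosed_iff (FractionRing R)).mpr fun {x} hx => ?_
  obtain ⟨c, hc, hcx⟩ := hx.isAlmostIntegral
  obtain ⟨a, b, hb, rfl⟩ := IsFractionRing.div_surjective (A := R) x
  have hb0 : algebraMap R (FractionRing R) b ≠ 0 := by
    simpa using nonZeroDivisors.ne_zero hb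
  obtain ⟨y, rfl⟩ := h a b c (nonZeroDivisors.ne_zero hc) fun k => by
    obtain ⟨d, hd⟩ := hcx k
    refine ⟨d, IsFractionRing.injective R (FractionRing R) ?_⟩
    rw [map_mul, map_mul, hd, Algebra.smul_def, map_pow, map_pow, div_pow]
    field_simp
  refine ⟨y, ?_⟩
  rw [map_mul]
  field_simp

/-- The hypothesis survives replacing `a` by a remainder `a - b q`, which lets the division be
iterated. -/
lemma dvd_mul_sub_pow {R : Type*} [CommRing R] {a b c : R} (h : ∀ k, b ^ k ∣ c * a ^ k) (q : R)
    (k : ℕ) : b ^ k ∣ c * (a - b * q) ^ k := by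
  rw [sub_eq_add_neg, add_pow, Finset.mul_sum]
  refine Finset.dvd_sum fun i hi => ?_
  have hi' : i ≤ k := Nat.lt_succ_iff.mp (Finset.mem_range.mp hi)
  rw [show c * (a ^ i * (-(b * q)) ^ (k - i) * (k.choose i : R)) =
    (c * a ^ i) * (b ^ (k - i) * ((-q) ^ (k - i) * (k.choose i : R))) by
      rw [← mul_neg, mul_pow]; ring]
  calc b ^ k = b ^ i * b ^ (k - i) := by rw [← pow_add, Nat.add_sub_cancel' hi']
    _ ∣ _ := mul_dvd_mul (h i) (Dvd.intro _ rfl)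

-- One division step: the lowest coefficients satisfy the same hypothesis over `R`, so that of `g`
-- divides that of `f`; once `ord g ≤ ord f`, the lowest term of `f` can be cancelled.
open PowerSeries in
theorem PowerSeries.exists_X_pow_succ_dvd_sub {R : Type*} [CommRing R] [IsDomain R]
    (hR : IsCompletelyIntegrallyClosed R) {f g h : PowerSeries R} (hh : h ≠ 0)
    (hdvd : ∀ k, g ^ k ∣ h * f ^ k) {N : ℕ} (hN : X ^ N ∣ f) :
    ∃ q, X ^ (N + 1) ∣ f - g * q := by
  obtain rfl | hf := eq_or_ne f 0
  · exact ⟨0, by simp⟩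
  have hlc : constantCoeff (divXPowOrder g) ∣ constantCoeff (divXPowOrder f) := by
    refine hR _ _ (constantCoeff (divXPowOrder h))
      (constantCoeff_divXPowOrder_eq_zero_iff.not.mpr hh) fun k => ?_
    have := map_dvd constantCoeff (map_dvd divXPowOrderHom (hdvd k))
    simpa only [map_mul, map_pow, coe_divXPowOrderHom] using this
  have hg : g ≠ 0 := by
    rintro rfl
    rw [divXPowOrder_zero, map_zero, zero_dvd_iff, constantCoeff_divXPowOrder_eq_zero_iff] at hlc
    exact hf hlc
  have hord : g.order.toNat ≤ f.order.toNat := by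
    by_contra! hlt
    -- The exponent `k = ord h + 1` suffices: `k · ord g ≤ ord h + k · ord f` fails if `ord g > ord
    -- f`.
    obtain ⟨w, hw⟩ := hdvd (h.order.toNat + 1)
    have hw0 : w ≠ 0 := by
      rintro rfl
      rw [mul_zero, mul_eq_zero] at hw
      exact hw.elim hh (pow_ne_zero _ hf)
    have h1 := congrArg order hw
    rw [order_mul, order_mul, order_pow, order_pow, ← coe_toNat_order hh, ← coe_toNat_order hf,
      ← coe_toNat_order hg, ← coe_toNat_order hw0, nsmul_eq_mul, nsmul_eq_mul] at h1
    simp only [ENat.toNat_natCast] at h1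
    have h2 : h.order.toNat + (h.order.toNat + 1) * f.order.toNat =
      (h.order.toNat + 1) * g.order.toNat + w.order.toNat := by exact_mod_cast h1
    nlinarith
  have hle : N ≤ f.order.toNat := by
    rw [← Nat.cast_le (α := ℕ∞), coe_toNat_order hf]
    exact le_order _ _ fun i hi => X_pow_dvd_iff.mp hN i (by exact_mod_cast hi)
  obtain ⟨r, hr⟩ := hlc
  refine ⟨C r * X ^ (f.order.toNat - g.order.toNat), ?_⟩
  have h1 : f - g * (C r * X ^ (f.order.toNat - g.order.toNat)) =
      X ^ f.order.toNat * (divXPowOrder f - divXPowOrder g * C r) := by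
    have h2 : (X : PowerSeries R) ^ f.order.toNat =
      X ^ g.order.toNat * X ^ (f.order.toNat - g.order.toNat) := by
        rw [← pow_add, Nat.add_sub_cancel' hord]
    have h3 := X_pow_order_mul_divXPowOrder (f := f)
    have h4 := X_pow_order_mul_divXPowOrder (f := g)
    rw [mul_sub, h3, h2]
    linear_combination (C r * X ^ (f.order.toNat - g.order.toNat)) * h4
  rw [h1]
  calc X ^ (N + 1) ∣ (X : PowerSeries R) ^ (f.order.toNat + 1) := pow_dvd_pow _ (by lia)
    _ = X ^ f.order.toNat * X := pow_succ _ _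
    _ ∣ _ := mul_dvd_mul_left _ (X_dvd_iff.mpr (by
      rw [map_sub, map_mul, hr, constantCoeff_C, sub_self]))

-- Iterated division puts `f` in `(g) + (X^N)` for every `N`; Krull's intersection theorem in
-- `R⟦X⟧/(g)` then gives `g ∣ f`.
open PowerSeries in
theorem PowerSeries.isCompletelyIntegrallyClosed {R : Type*} [CommRing R] [IsDomain R]
    [IsLocalRing R] [IsNoetherianRing R] (hR : IsCompletelyIntegrallyClosed R) :
    IsCompletelyIntegrallyClosed (PowerSeries R) := by
  intro f g h hh hdvd
  have key (N : ℕ) : ∃ q, X ^ N ∣ f - g * q := by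
    induction N with
    | zero => exact ⟨0, by simp⟩
    | succ N ih =>
      obtain ⟨q, hq⟩ := ih
      obtain ⟨q', hq'⟩ := exists_X_pow_succ_dvd_sub hR hh (dvd_mul_sub_pow hdvd q) hq
      exact ⟨q + q', by rwa [mul_add, ← sub_sub]⟩
  rw [← Ideal.mem_span_singleton, ← Ideal.Quotient.eq_zero_iff_mem,
    ← Submodule.mem_bot (PowerSeries R),
    ← Ideal.iInf_pow_smul_eq_bot_of_isLocalRing (M := PowerSeries R ⧸ Ideal.span {g})
      (maximalIdeal (PowerSeries R)) (maximalIdeal.isMaximal _).ne_top, Submodule.mem_iInf]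
  intro N
  obtain ⟨q, w, hw⟩ := key N
  have hfw : Ideal.Quotient.mk (Ideal.span {g}) f =
      (X : PowerSeries R) ^ N • Ideal.Quotient.mk (Ideal.span {g}) w := by
    rw [← Ideal.Quotient.mk_eq_mk, ← Ideal.Quotient.mk_eq_mk, ← Submodule.Quotient.mk_smul,
      Submodule.Quotient.eq, Ideal.mem_span_singleton]
    exact ⟨q, by rw [smul_eq_mul, ← hw, sub_sub_cancel]⟩
  rw [hfw]
  refine Submodule.smul_mem_smul (Ideal.pow_mem_pow ?_ N) trivial
  rw [IsLocalRing.mem_maximalIdeal, mem_nonunits_iff, isUnit_iff_constantCoeff, constantCoeff_X]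
  exact not_isUnit_zero

theorem MvPowerSeries.isCompletelyIntegrallyClosed (K : Type*) [Field K] (n : ℕ) :
    IsCompletelyIntegrallyClosed (MvPowerSeries (Fin n) K) := by
  induction n with
  | zero =>
    let e : K ≃+* MvPowerSeries (Fin 0) K :=
      RingEquiv.ofBijective C ⟨C_injective, C_surjective⟩
    exact (Field.isCompletelyIntegrallyClosed K).of_ringEquiv e
  | succ n ih =>
    have : IsDomain (MvPowerSeries (Fin n) K) := NoZeroDivisors.to_isDomain _
    exact (PowerSeries.isCompletelyIntegrallyClosed ih).of_ringEquiv
      (finSuccEquiv K n).symm.toRingEquiv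

/-- Divide in the full power series ring; a quotient of two invariants is again invariant. -/
instance {E : Type u} [Field E] {n : ℕ} : IsIntegrallyClosed (evenInvariants E n) := by
  refine IsCompletelyIntegrallyClosed.isIntegrallyClosed fun a b c hc h => ?_
  have : IsDomain (MvPowerSeries (Fin n) E) := NoZeroDivisors.to_isDomain _
  obtain ⟨q, hq⟩ := MvPowerSeries.isCompletelyIntegrallyClosed E n a b c
    (by simpa using hc) fun k => by simpa using map_dvd (evenInvariants E n).val (h k)
  obtain rfl | hb := eq_or_ne b 0
  · refine ⟨0, Subtype.ext ?_⟩
    rw [hq]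
    simp
  have hb' : (b : MvPowerSeries (Fin n) E) ≠ 0 := by simpa using hb
  refine ⟨⟨q, (mem_evenInvariants_iff_negVars E n).mpr (mul_left_cancel₀ hb' ?_)⟩, Subtype.ext hq⟩
  have h1 := congrArg (negVars E n) hq
  rw [map_mul, (mem_evenInvariants_iff_negVars E n).mp a.2,
    (mem_evenInvariants_iff_negVars E n).mp b.2] at h1
  rw [← h1, hq]

end CompleteIntegralClosedness

/-! ### Adic completeness. -/

section Completeness

open MvPowerSeries Finsupp

/-- A ring of power series in which the powers of an ideal are given by vanishing conditions on
the coefficients of small degree is complete. -/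
theorem MvPowerSeries.isAdicComplete_of_mem_pow_iff {σ E R : Type*} [CommRing E] [CommRing R]
    {I : Ideal R} {θ : R →+ MvPowerSeries σ E} {T : Set (σ →₀ ℕ)} {d : ℕ} (hd : 0 < d)
    (hθ : Function.Injective θ)
    (hrange : ∀ f, (∀ m, coeff m f ≠ 0 → m ∈ T) → f ∈ Set.range θ)
    (hT : ∀ v m, coeff m (θ v) ≠ 0 → m ∈ T)
    (hpow : ∀ k b, b ∈ I ^ k ↔ ∀ m, coeff m (θ b) ≠ 0 → d * k ≤ m.degree) :
    IsAdicComplete I R where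
  haus' b hb := by
    refine hθ (MvPowerSeries.ext fun m => ?_)
    rw [map_zero, coeff_zero]
    by_contra hne
    have h := hb (m.degree + 1)
    rw [SModEq.zero, smul_eq_mul, Ideal.mul_top, hpow] at h
    have := h m hne
    nlinarith
  prec' f hf := by
    have hf' {i j : ℕ} (hij : i ≤ j) {m : σ →₀ ℕ} (hm : m.degree < d * i) :
        coeff m (θ (f i)) = coeff m (θ (f j)) := by
      have h := hf hij
      rw [SModEq.sub_mem, smul_eq_mul, Ideal.mul_top, hpow] at h
      by_contra hne
      have := h m (by rwa [map_sub, map_sub, sub_ne_zero])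
      lia
    -- Coefficients of degree `r` are stable from index `r + 1` on, because `r < d (r + 1)`.
    let L : MvPowerSeries σ E := fun m => coeff m (θ (f (m.degree + 1)))
    have hLc (m) : coeff m L = coeff m (θ (f (m.degree + 1))) := rfl
    obtain ⟨L', hL'⟩ := hrange L fun m hm => hT _ m (by rwa [← hLc])
    refine ⟨L', fun k => ?_⟩
    rw [SModEq.sub_mem, smul_eq_mul, Ideal.mul_top, hpow]
    intro m hm
    by_contra! hlt
    refine hm ?_
    rw [map_sub, map_sub, hL', hLc, sub_eq_zero]
    obtain h | h := le_total k (m.degree + 1)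
    · exact hf' h hlt
    · exact (hf' h (by nlinarith)).symm

variable {E : Type u} [Field E] {n : ℕ}

/-- The bound is written `1 * k` to be the case `d = 1` of `isAdicComplete_of_mem_pow_iff`. -/
lemma MvPowerSeries.mem_maximalIdeal_pow_iff {k : ℕ} {f : MvPowerSeries (Fin n) E} :
    f ∈ maximalIdeal (MvPowerSeries (Fin n) E) ^ k ↔ ∀ m, coeff m f ≠ 0 → 1 * k ≤ m.degree := by
  simp only [one_mul]
  constructor
  · intro hf
    suffices h : (k : ℕ∞) ≤ f.order from fun m hm => by
      exact_mod_cast h.trans (order_le hm)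
    induction k generalizing f with
    | zero => simp
    | succ k ih =>
      rw [pow_succ] at hf
      refine Submodule.mul_induction_on hf (fun a ha b hb => ?_)
        fun a b ha hb => (le_min ha hb).trans min_order_le_add
      rw [Nat.cast_succ]
      exact (add_le_add (ih ha) (one_le_order_iff_constCoeff_eq_zero.mpr
        (mem_maximalIdeal_iff.mp hb))).trans le_order_mul
  · intro hf
    induction k generalizing f with
    | zero => simp
    | succ k ih =>
      obtain ⟨g, hg, hg'⟩ := exists_eq_sum_monomial_mul (fun i => single i 1) f fun m hm =>
        exists_single_one_le (by have := hf m hm; lia)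
      rw [hg, pow_succ']
      refine Ideal.sum_mem _ fun i _ => Ideal.mul_mem_mul ?_ (ih fun m hm => ?_)
      · exact mem_maximalIdeal_iff.mpr (constantCoeff_X i)
      · have := hf _ (hg' i m hm)
        simp only [map_add, degree_single] at this
        lia

instance : IsAdicComplete (maximalIdeal (MvPowerSeries (Fin n) E)) (MvPowerSeries (Fin n) E) :=
  isAdicComplete_of_mem_pow_iff (θ := AddMonoidHom.id _) (T := Set.univ) one_pos
    Function.injective_id (fun f _ => ⟨f, rfl⟩) (fun _ _ _ => trivial)
    fun _ _ => mem_maximalIdeal_pow_iff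

variable [CharZero E]

namespace evenInvariants

lemma mem_maximalIdeal_pow_iff {k : ℕ} {b : evenInvariants E n} :
    b ∈ maximalIdeal (evenInvariants E n) ^ k ↔
      ∀ m, coeff m (b : MvPowerSeries (Fin n) E) ≠ 0 → 2 * k ≤ m.degree := by
  refine ⟨fun hb => ?_, mem_maximalIdeal_pow⟩
  suffices h : ((2 * k : ℕ) : ℕ∞) ≤ (b : MvPowerSeries (Fin n) E).order from fun m hm => by
    exact_mod_cast h.trans (order_le hm)
  induction k generalizing b with
  | zero => simp
  | succ k ih =>
    rw [pow_succ] at hb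
    refine Submodule.mul_induction_on hb (fun a ha b hb => ?_)
      fun a b ha hb => (le_min ha hb).trans min_order_le_add
    rw [mul_add_one, Nat.cast_add]
    refine (add_le_add (ih ha) (nat_le_order fun m hm => ?_)).trans le_order_mul
    by_contra hne
    exact hm.not_ge (two_le_degree_of_coeff_ne_zero hb hne)

instance : IsAdicComplete (maximalIdeal (evenInvariants E n)) (evenInvariants E n) :=
  isAdicComplete_of_mem_pow_iff (θ := (evenInvariants E n).val.toAddMonoidHom)
    (T := parityExponents 0) two_pos Subtype.val_injective
    (fun f hf => ⟨⟨f, (mem_evenInvariants_iff E n).mpr hf⟩, rfl⟩)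
    (fun v => (mem_evenInvariants_iff E n).mp v.2) fun _ _ => mem_maximalIdeal_pow_iff

end evenInvariants

end Completeness

/-! ### Regularity for `n = 1`; failure of regularity and of the complete intersection property. -/

section Regularity

open MvPowerSeries Finsupp

variable {E : Type u} [Field E] [CharZero E]

namespace evenInvariants

lemma isRegularLocalRing_one : IsRegularLocalRing (evenInvariants E 1) := by
  refine .of_span_range (N := 1) (u := fun _ => XX E 0 0) ?_ (by rw [ringKrullDim_eq])
  rw [← span_range_quadric]
  congr 1
  ext b
  constructor
  · rintro ⟨i, rfl⟩
    exact ⟨s(0, 0), rfl⟩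
  · rintro ⟨s, rfl⟩
    refine ⟨0, ?_⟩
    induction s with | _ i j
    rw [Subsingleton.elim i 0, Subsingleton.elim j 0]
    rfl

end evenInvariants

theorem IsRegularLocalRing.exists_span_range (R : Type*) [CommRing R] [IsRegularLocalRing R] :
    ∃ (N : ℕ) (u : Fin N → R), Ideal.span (Set.range u) = maximalIdeal R ∧
      (N : WithBot ℕ∞) = ringKrullDim R := by
  obtain ⟨s, hs, hspan⟩ :=
    Submodule.FG.exists_span_finset_card_eq_spanFinrank (maximalIdeal R).fg_of_isNoetherianRing
  refine ⟨s.card, fun i => s.equivFin.symm i, ?_, ?_⟩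
  · rw [← hspan, Ideal.span]
    congr 1
    ext x
    constructor
    · rintro ⟨i, rfl⟩
      exact (s.equivFin.symm i).2
    · intro hx
      exact ⟨s.equivFin ⟨x, hx⟩, by simp⟩
  · rw [hs, (isRegularLocalRing_iff R).mp inferInstance]

namespace evenInvariants

/-- The maximal ideal needs `n + n(n-1)/2` generators, more than the dimension `n`. -/
theorem not_isRegularLocalRing {n : ℕ} (hn : 2 ≤ n) :
    ¬ IsRegularLocalRing (evenInvariants E n) := fun h => by
  obtain ⟨N, u, hu, hN⟩ := IsRegularLocalRing.exists_span_range (evenInvariants E n)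
  have h1 := card_sym2_le hu
  rw [ringKrullDim_eq, Nat.cast_inj] at hN
  rw [Sym2.card, Fintype.card_fin, Nat.choose_succ_succ' n 1, Nat.choose_one_right, hN] at h1
  have : 0 < n.choose 2 := Nat.choose_pos hn
  lia

/-- The ring is its own completion, so the presentation is one of the ring itself, and the dimension
formula for a regular sequence gives `n + rs.length = N`. -/
theorem not_isCompleteIntersectionLocalRing {n : ℕ} (hn : 3 ≤ n) :
    ¬ IsCompleteIntersectionLocalRing (evenInvariants E n) := fun h => by
  obtain ⟨S, _, _, rs, hreg, ⟨e⟩⟩ := h.exists_presentation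
  let e' : (S ⧸ Ideal.ofList rs) ≃+* evenInvariants E n :=
    e.trans (AdicCompletion.ofAlgEquiv (maximalIdeal (evenInvariants E n))).symm.toRingEquiv
  obtain ⟨N, u, hu, hN⟩ := IsRegularLocalRing.exists_span_range S
  have hdim := ringKrullDim_add_length_eq_ringKrullDim_of_isRegular rs hreg
  rw [ringKrullDim_eq_of_ringEquiv e', ringKrullDim_eq, ← hN] at hdim
  have hdim' : n + rs.length = N := by exact_mod_cast hdim
  refine IsLocalRing.false_of_presentation (B := evenInvariants E n) (y := quadric E) hn ?_ ?_ ?_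
    hu hN.le (g := rs.get) (π := e'.toRingHom.comp (Ideal.Quotient.mk _)) ?_ ?_ (by lia)
  · exact span_range_quadric
  · intro N u hu
    exact card_sym2_le hu
  · exact quadric_mul_quadric
  · exact e'.surjective.comp Ideal.Quotient.mk_surjective
  rw [Set.range_list_get]
  ext a
  rw [RingHom.mem_ker, RingHom.comp_apply]
  change e' _ = 0 ↔ _
  rw [map_eq_zero_iff e' e'.injective, Ideal.Quotient.eq_zero_iff_mem]

end evenInvariants

end Regularity

/-! ### The quadric cone for `n = 2`, and the Gorenstein properties. -/

section Quadric

open MvPowerSeries Finsupp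

variable {E : Type u} [Field E]

namespace evenInvariants

variable (E) in
/-- The quadratic polynomial `T ^ 2 - x y` over `E⟦x, y⟧`. -/
noncomputable def conePolynomial : Polynomial (MvPowerSeries (Fin 2) E) :=
  Polynomial.X ^ 2 - Polynomial.C (X 0 * X 1)

lemma natDegree_conePolynomial : (conePolynomial E).natDegree = 2 :=
  Polynomial.natDegree_X_pow_sub_C

lemma monic_conePolynomial : (conePolynomial E).Monic :=
  Polynomial.monic_X_pow_sub_C _ two_ne_zero

lemma isDistinguishedAt_conePolynomial :
    (conePolynomial E).IsDistinguishedAt (maximalIdeal (MvPowerSeries (Fin 2) E)) where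
  monic := monic_conePolynomial
  mem {k} hk := by
    rw [natDegree_conePolynomial] at hk
    rw [conePolynomial, Polynomial.coeff_sub, Polynomial.coeff_X_pow, if_neg hk.ne, zero_sub,
      neg_mem_iff, Polynomial.coeff_C]
    split_ifs
    · exact MvPowerSeries.mem_maximalIdeal_iff.mpr (by simp)
    · exact Ideal.zero_mem _

variable [CharZero E]

variable (E) in
/-- Evaluation at the product of the two variables. -/
noncomputable def evalXY : Polynomial (MvPowerSeries (Fin 2) E) →+* evenInvariants E 2 :=
  Polynomial.eval₂RingHom (expandHom E 2) (XX E 0 1)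

lemma evalXY_linear (a b : MvPowerSeries (Fin 2) E) :
    (evalXY E (Polynomial.C a * Polynomial.X + Polynomial.C b) : MvPowerSeries (Fin 2) E) =
      expand 2 two_ne_zero a * monomial (onesExponent 2) 1 +
        expand 2 two_ne_zero b * monomial 0 1 := by
  have h1 : (XX E (0 : Fin 2) 1 : MvPowerSeries (Fin 2) E) = monomial (onesExponent 2) 1 := by
    have h : single (0 : Fin 2) 1 + single 1 1 = onesExponent 2 := Finsupp.ext fun i => by
      fin_cases i <;> simp [onesExponent_apply]
    rw [coe_XX, h]
  rw [evalXY, map_add, map_mul, Polynomial.coe_eval₂RingHom, Polynomial.eval₂_C,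
    Polynomial.eval₂_C, Polynomial.eval₂_X, Subalgebra.coe_add, Subalgebra.coe_mul,
    coe_expandHom, coe_expandHom, h1, monomial_zero_one, mul_one]

lemma onesExponent_two_mem :
    (∀ i, onesExponent 2 i ≤ 1) ∧ onesExponent 2 ∈ parityExponents 0 :=
  ⟨fun _ => le_rfl, by rw [parityExponents, Set.mem_ofPred_eq, degree_onesExponent]; rfl⟩

lemma zero_mem_squarefreeExponents :
    (∀ i, (0 : Fin 2 →₀ ℕ) i ≤ 1) ∧ (0 : Fin 2 →₀ ℕ) ∈ parityExponents 0 :=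
  ⟨fun _ => Nat.zero_le _, by simp [parityExponents]⟩

lemma eq_ones_or_eq_zero (s : SquarefreeExponents 2 0) :
    s = ⟨onesExponent 2, onesExponent_two_mem⟩ ∨ s = ⟨0, zero_mem_squarefreeExponents⟩ := by
  obtain ⟨s, hs, hp⟩ := s
  rw [parityExponents, Set.mem_ofPred_eq, degree_eq_sum, Fin.sum_univ_two,
    ZMod.natCast_eq_zero_iff_even] at hp
  have h0 := hs 0
  have h1 := hs 1
  obtain ⟨k, hk⟩ := hp
  obtain h | h := Nat.le_one_iff_eq_zero_or_eq_one.mp h0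
  · right
    refine Subtype.ext (Finsupp.ext fun i => ?_)
    fin_cases i
    · exact h
    · change s 1 = 0
      lia
  · left
    refine Subtype.ext (Finsupp.ext fun i => ?_)
    fin_cases i
    · exact h
    · change s 1 = 1
      lia

lemma ones_ne_zero : (⟨onesExponent 2, onesExponent_two_mem⟩ : SquarefreeExponents 2 0) ≠
    ⟨0, zero_mem_squarefreeExponents⟩ := fun h => by
  have := DFunLike.congr_fun (congrArg Subtype.val h) 0
  simp [onesExponent_apply] at this

lemma strided_monomial [DecidableEq (SquarefreeExponents 2 0)] (s t : SquarefreeExponents 2 0) :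
    strided (t : Fin 2 →₀ ℕ) (monomial (s : Fin 2 →₀ ℕ) (1 : E)) =
      (Pi.single s 1 : SquarefreeExponents 2 0 → MvPowerSeries (Fin 2) E) t :=
  congrFun (linearEquivPi_squarefreeMonomial s) t

lemma strided_ones_evalXY (a b : MvPowerSeries (Fin 2) E) : strided (onesExponent 2)
    (evalXY E (Polynomial.C a * Polynomial.X + Polynomial.C b) : MvPowerSeries (Fin 2) E) = a := by
  classical
  have h1 := strided_monomial (E := E) ⟨onesExponent 2, onesExponent_two_mem⟩
    ⟨onesExponent 2, onesExponent_two_mem⟩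
  have h2 := strided_monomial (E := E) ⟨0, zero_mem_squarefreeExponents⟩
    ⟨onesExponent 2, onesExponent_two_mem⟩
  rw [Pi.single_eq_same] at h1
  rw [Pi.single_eq_of_ne ones_ne_zero] at h2
  rw [evalXY_linear, map_add, strided_expand_mul onesExponent_two_mem.1,
    strided_expand_mul onesExponent_two_mem.1]
  dsimp only at h1 h2
  rw [h1, h2, mul_one, mul_zero, add_zero]

lemma strided_zero_evalXY (a b : MvPowerSeries (Fin 2) E) : strided 0
    (evalXY E (Polynomial.C a * Polynomial.X + Polynomial.C b) : MvPowerSeries (Fin 2) E) = b := by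
  classical
  have h1 := strided_monomial (E := E) ⟨onesExponent 2, onesExponent_two_mem⟩
    ⟨0, zero_mem_squarefreeExponents⟩
  have h2 := strided_monomial (E := E) ⟨0, zero_mem_squarefreeExponents⟩
    ⟨0, zero_mem_squarefreeExponents⟩
  rw [Pi.single_eq_same] at h2
  rw [Pi.single_eq_of_ne ones_ne_zero.symm] at h1
  rw [evalXY_linear, map_add, strided_expand_mul zero_mem_squarefreeExponents.1,
    strided_expand_mul zero_mem_squarefreeExponents.1]
  dsimp only at h1 h2
  rw [h1, h2, mul_one, mul_zero, zero_add]

lemma evalXY_surjective : Function.Surjective (evalXY E) := fun b => by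
  refine ⟨Polynomial.C (strided (onesExponent 2) (b : MvPowerSeries (Fin 2) E)) * Polynomial.X +
    Polynomial.C (strided 0 (b : MvPowerSeries (Fin 2) E)), Subtype.ext ?_⟩
  refine parityPart_ext (mem_evenInvariants_iff_mem_parityPart.mp (Subtype.property _))
    (mem_evenInvariants_iff_mem_parityPart.mp b.2) fun s => ?_
  obtain rfl | rfl := eq_ones_or_eq_zero s
  · exact strided_ones_evalXY _ _
  · exact strided_zero_evalXY _ _

lemma evalXY_conePolynomial : evalXY E (conePolynomial E) = 0 := by
  refine Subtype.ext ?_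
  rw [conePolynomial, evalXY, map_sub, map_pow, Polynomial.coe_eval₂RingHom, Polynomial.eval₂_C,
    Polynomial.eval₂_X, Subalgebra.coe_sub, Subalgebra.coe_pow, coe_expandHom, map_mul, expand_X,
    expand_X]
  change (X 0 * X 1) ^ 2 - X 0 ^ 2 * X 1 ^ 2 = (0 : MvPowerSeries (Fin 2) E)
  ring

/-- Modulo the monic cone polynomial every polynomial is some `aT + b`, and `1`, `xy` are
independent over the power series in `x²`, `y²`. -/
lemma ker_evalXY : RingHom.ker (evalXY E) = Ideal.span {conePolynomial E} := by
  refine le_antisymm (fun p hp => ?_) ?_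
  · rw [Ideal.mem_span_singleton, ← Polynomial.modByMonic_eq_zero_iff_dvd (monic_conePolynomial (E := E))]
    have h1 : evalXY E (p %ₘ conePolynomial E) = 0 := by
      have h := congrArg (evalXY E) (Polynomial.modByMonic_add_div p (conePolynomial E))
      rwa [map_add, map_mul, evalXY_conePolynomial, zero_mul, add_zero,
        (RingHom.mem_ker).mp hp] at h
    have h2 : (p %ₘ conePolynomial E).natDegree ≤ 1 := by
      have := Polynomial.natDegree_modByMonic_lt p (monic_conePolynomial (E := E)) fun h => by
        have := natDegree_conePolynomial (E := E)
        rw [h, Polynomial.natDegree_one] at this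
        lia
      rw [natDegree_conePolynomial] at this
      lia
    obtain ⟨a, b, hab⟩ := Polynomial.exists_eq_X_add_C_of_natDegree_le_one h2
    rw [hab] at h1 ⊢
    have ha := strided_ones_evalXY a b
    have hb := strided_zero_evalXY a b
    rw [h1, ZeroMemClass.coe_zero, map_zero] at ha hb
    rw [← ha, ← hb, map_zero, zero_mul, zero_add]
  · rw [Ideal.span_singleton_le_iff_mem, RingHom.mem_ker]
    exact evalXY_conePolynomial

/-- The cone polynomial is distinguished, so by Weierstrass division its quotients of `E⟦x, y⟧[T]`
and `E⟦x, y⟧⟦T⟧` agree; the latter ring is regular, being a power series ring in three variables. -/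
theorem isCompleteIntersectionLocalRing_two :
    IsCompleteIntersectionLocalRing (evenInvariants E 2) where
  exists_presentation := by
    have : IsDomain (MvPowerSeries (Fin 2) E) := NoZeroDivisors.to_isDomain _
    have hreg : IsRegularLocalRing (PowerSeries (MvPowerSeries (Fin 2) E)) :=
      have := MvPowerSeries.isRegularLocalRing (E := E) (n := 3)
      .of_ringEquiv (R := MvPowerSeries (Fin 3) E) (finSuccEquiv E 2).toRingEquiv
    have hg0 : (conePolynomial E : PowerSeries (MvPowerSeries (Fin 2) E)) ≠ 0 := by
      rw [Ne, Polynomial.coe_eq_zero_iff]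
      exact monic_conePolynomial.ne_zero
    refine ⟨PowerSeries (MvPowerSeries (Fin 2) E), inferInstance, hreg, [conePolynomial E], ?_,
      ⟨?_⟩⟩
    · refine .of_isWeaklyRegular_of_mem_maximalIdeal _ (fun r hr => ?_)
        ((RingTheory.Sequence.isWeaklyRegular_singleton_iff _ _).mpr
          fun a b h => mul_left_cancel₀ hg0 h)
      rw [List.mem_singleton.mp hr, IsLocalRing.mem_maximalIdeal, mem_nonunits_iff,
        PowerSeries.isUnit_iff_constantCoeff, ← mem_nonunits_iff, ← IsLocalRing.mem_maximalIdeal,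
        ← PowerSeries.coeff_zero_eq_constantCoeff_apply, Polynomial.coeff_coe]
      exact isDistinguishedAt_conePolynomial.mem (by rw [natDegree_conePolynomial]; lia)
    · exact (Ideal.quotEquivOfEq (Ideal.ofList_singleton _)).trans
        ((isDistinguishedAt_conePolynomial (E := E)).algEquivQuotient.symm.toRingEquiv.trans
        ((Ideal.quotEquivOfEq ker_evalXY.symm).trans
        ((RingHom.quotientKerEquivOfSurjective evalXY_surjective).trans
        (AdicCompletion.ofAlgEquiv (maximalIdeal (evenInvariants E 2))).toRingEquiv)))

theorem isTwoGorensteinLocalRing {n : ℕ} (hn : Odd n) (hn3 : 3 ≤ n) :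
    IsTwoGorensteinLocalRing (evenInvariants E n) where
  exists_canonicalModule := ⟨parityPart E n 1, inferInstance, inferInstance,
    isCanonicalModule hn, nonempty_dual_dual_linearEquiv (by lia)⟩

theorem isGorensteinLocalRing {n : ℕ} (hn : Even n) :
    IsGorensteinLocalRing (evenInvariants E n) where
  exists_hasInjectiveDimensionLE := ⟨n, hasInjectiveDimensionLE_of_even hn⟩

end evenInvariants

end Quadric

theorem mainTheorem10 (E : Type u) [Field E] [CharZero E] (n : ℕ) :
    (IsDomain (evenInvariants E n) ∧ IsIntegrallyClosed (evenInvariants E n)) ∧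
    IsCohenMacaulayLocalRing (evenInvariants E n) ∧
    (n = 1 → IsRegularLocalRing (evenInvariants E n)) ∧
    (n = 2 → IsCompleteIntersectionLocalRing (evenInvariants E n) ∧
      ¬ IsRegularLocalRing (evenInvariants E n)) ∧
    (Odd n → 3 ≤ n → IsTwoGorensteinLocalRing (evenInvariants E n) ∧
      ¬ IsGorensteinLocalRing (evenInvariants E n)) ∧
    (Even n → 4 ≤ n → IsGorensteinLocalRing (evenInvariants E n) ∧
      ¬ IsCompleteIntersectionLocalRing (evenInvariants E n)) := by
  refine ⟨⟨inferInstance, inferInstance⟩, inferInstance, ?_, ?_, fun hn hn3 => ?_,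
    fun hn hn4 => ?_⟩
  · rintro rfl
    exact evenInvariants.isRegularLocalRing_one
  · rintro rfl
    exact ⟨evenInvariants.isCompleteIntersectionLocalRing_two,
      evenInvariants.not_isRegularLocalRing le_rfl⟩
  · exact ⟨evenInvariants.isTwoGorensteinLocalRing hn hn3,
      evenInvariants.not_isGorensteinLocalRing hn hn3⟩
  · exact ⟨evenInvariants.isGorensteinLocalRing hn,
      evenInvariants.not_isCompleteIntersectionLocalRing (by lia)⟩
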